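/- Let $\mathrm{Ai}$ and $\mathrm{Bi}$ be the Airy functions. For a constant $\vartheta\in\mathbb{C}$ put $$\varphi(z;\vartheta)=\cos(\vartheta)\,\mathrm{Ai}(t)+\sin(\vartheta)\,\mathrm{Bi}(t),\qquad t=-2^{-1/3}z,$$ let $\tau_0(z;\vartheta)=1$ and, for $n\ge 1$, $$\tau_n(z;\vartheta)=\det\left[\frac{d^{\,j+k}}{dz^{\,j+k}}\varphi(z;\vartheta)\right]_{j,k=0}^{n-1},$$ and let $$p_n(z;\vartheta)=-2\frac{d^2}{dz^2}\ln\tau_n(z;\vartheta),\qquad \sigma_n(z;\vartheta)=\frac{d}{dz}\ln\tau_n(z;\vartheta)=\frac{\tau_n'(z;\vartheta)}{\tau_n(z;\vartheta)}.$$ Let $n\ge 0$ be an integer and $\vartheta\in\mathbb{C}$. Then $\tau_n(z;\vartheta)\neq 0$ for all sufficiently large negative real $z$, and the following expansions hold as $z\to-\infty$ along the real axis, with implied constants that may depend on $n$ and $\vartheta$. If $\sin\vartheta=0$ (in particular if $\vartheta=0$), then $$p_n(z;\vartheta)=\frac{n}{\sqrt2\,(-z)^{1/2}}-\frac{n^2}{2z^2}+\frac{5n(4n^2+1)}{16\sqrt2\,(-z)^{7/2}}+\mathcal{O}(z^{-5}),$$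 $$\sigma_n(z;\vartheta)=\frac{n(-z)^{1/2}}{\sqrt2}-\frac{n^2}{4z}-\frac{n(4n^2+1)}{16\sqrt2\,(-z)^{5/2}}+\mathcal{O}(z^{-4}).$$ If $\sin\vartheta\neq0$, then $$p_n(z;\vartheta)=-\frac{n}{\sqrt2\,(-z)^{1/2}}-\frac{n^2}{2z^2}-\frac{5n(4n^2+1)}{16\sqrt2\,(-z)^{7/2}}+\mathcal{O}(z^{-5}),$$ $$\sigma_n(z;\vartheta)=-\frac{n(-z)^{1/2}}{\sqrt2}-\frac{n^2}{4z}+\frac{n(4n^2+1)}{16\sqrt2\,(-z)^{5/2}}+\mathcal{O}(z^{-4}).$$ -/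

import Mathlib

open Filter Asymptotics Topology

noncomputable section

namespace AiryPainleve

/-- The contour integral `∫ exp (t ^ 3 / 3 - z * t) dt` along the ray `t = s * ω`, `0 < s < ∞`,
from the origin to infinity. It is used only for `ω = exp (± π i / 3)` and `ω = -1`, for which
`ω ^ 3 = -1` and the integrand decays like `exp (- s ^ 3 / 3)`. -/
def rayIntegral (ω z : ℂ) : ℂ :=
  ∫ s in Set.Ioi (0 : ℝ), Complex.exp ((s * ω) ^ 3 / 3 - z * (s * ω)) * ω

/-- The direction `exp (π i / 3)`. -/
def ωPlus : ℂ := Complex.exp (Real.pi * Complex.I / 3)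

/-- The direction `exp (- π i / 3)`. -/
def ωMinus : ℂ := Complex.exp (-(Real.pi * Complex.I / 3))

/-- The Airy function `Ai z = (2 π i)⁻¹ ∫ exp (t ^ 3 / 3 - z t) dt`, the contour running from
`∞ exp (- π i / 3)` to `∞ exp (π i / 3)` (through the origin). -/
def Ai (z : ℂ) : ℂ :=
  1 / (2 * Real.pi * Complex.I) * (rayIntegral ωPlus z - rayIntegral ωMinus z)

/-- The Airy function of the second kind
`Bi z = (2 π)⁻¹ ∫ exp (t ^ 3 / 3 - z t) dt + (2 π)⁻¹ ∫ exp (t ^ 3 / 3 - z t) dt`, the first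
contour running from `-∞` to `∞ exp (π i / 3)`, the second from `-∞` to `∞ exp (- π i / 3)`
(both through the origin). -/
def Bi (z : ℂ) : ℂ :=
  1 / (2 * Real.pi) * (rayIntegral ωPlus z - rayIntegral (-1) z) +
    1 / (2 * Real.pi) * (rayIntegral ωMinus z - rayIntegral (-1) z)

/-- `φ(z; ϑ) = cos ϑ Ai(t) + sin ϑ Bi(t)` with `t = - 2 ^ (- 1 / 3) z`. -/
def φ (ϑ z : ℂ) : ℂ :=
  Complex.cos ϑ * Ai (-((2 : ℝ) ^ (-(1 / 3) : ℝ) : ℝ) * z) +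
    Complex.sin ϑ * Bi (-((2 : ℝ) ^ (-(1 / 3) : ℝ) : ℝ) * z)

/-- `τ_n(z; ϑ)`, the determinant of the `n × n` matrix of the derivatives of order `j + k` of
`φ(· ; ϑ)`, `0 ≤ j, k ≤ n - 1`; the empty determinant is `τ_0 = 1`. -/
def τ (n : ℕ) (ϑ z : ℂ) : ℂ :=
  (Matrix.of fun j k : Fin n => iteratedDeriv ((j : ℕ) + (k : ℕ)) (φ ϑ) z).det

/-- `σ_n = (ln τ_n)'`, that is, `τ_n' / τ_n`. -/
def σ (n : ℕ) (ϑ z : ℂ) : ℂ := logDeriv (τ n ϑ) z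

/-- `p_n = - 2 (ln τ_n)''`. -/
def p (n : ℕ) (ϑ z : ℂ) : ℂ := -2 * deriv (logDeriv (τ n ϑ)) z

end AiryPainleve

end

namespace AiryHankel

open MeasureTheory

/-! ### Symbol classes at infinity -/

/-! Put `x = -z` and `ψ(x) = φ(-x; ϑ)`, so that `ψ'' = xψ/2` and `v = ψ'/ψ` solves the Riccati
equation `v' = x/2 - v²`. Then `v ~ s√x` with `s² = 1/2`. If `sin ϑ = 0`, `ψ` is a multiple of `Ai`,
hence bounded, and `s = -1/√2`; otherwise `Bi` makes `ψ` unbounded and `s = 1/√2`. No Airy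
asymptotics are needed to decide this: `Re(ψ̄ψ')` is nondecreasing on `x ≥ 0`, so boundedness or
unboundedness fixes the sign of `Re v` (`logDeriv_re_nonpos_of_bounded`,
`logDeriv_re_nonneg_of_unbounded`). A comparison argument then gives `v - s√x = O(1/x)`
(`logDeriv_sub_isBigO`), and iterating the Riccati equation gives the case `n = 1`
(`symbol_logDeriv_sub_expansion`).

For larger `n`, let `Lₙ` be the logarithmic derivative of `τₙ(-x)`. Jacobi's determinant identity
gives `Lₙ' = τₙ₊₁τₙ₋₁/τₙ²`, hence the Toda recursion `Lₙ₊₁ = 2Lₙ - Lₙ₋₁ + Lₙ''/Lₙ'`, which the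
claimed expansion satisfies up to the stated error (`symbol_toda`). Each step differentiates twice,
which a bare `O` estimate does not survive; errors are therefore carried in symbol classes, where
every derivative gains a factor `1/x`. The expansion of `pₙ` then follows by differentiating that of
`σₙ`. -/

theorem eventually_eventually_nhds_atTop {P : ℝ → Prop} (h : ∀ᶠ x in atTop, P x) :
    ∀ᶠ x in atTop, ∀ᶠ y in 𝓝 x, P y := by
  obtain ⟨a, ha⟩ := eventually_atTop.1 h
  filter_upwards [eventually_gt_atTop a] with x hx
  filter_upwards [lt_mem_nhds hx] with y hy using ha y hy.le

theorem deriv_eventuallyEq_atTop {f g : ℝ → ℂ} (h : f =ᶠ[atTop] g) :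
    deriv f =ᶠ[atTop] deriv g := by
  filter_upwards [eventually_eventually_nhds_atTop h] with x hx
  exact EventuallyEq.deriv_eq hx

/-- `f` and its first `N` derivatives satisfy `f ^ (k) = O (x ^ (m - k))` as `x → ∞`. -/
def SymbolUpTo : ℕ → ℝ → (ℝ → ℂ) → Prop
  | 0, m, f => f =O[atTop] fun x : ℝ => x ^ m
  | N + 1, m, f => f =O[atTop] (fun x : ℝ => x ^ m) ∧
      (∀ᶠ x in atTop, DifferentiableAt ℝ f x) ∧ SymbolUpTo N (m - 1) (deriv f)

/-- The symbol class of order `m`: `f ^ (k) = O (x ^ (m - k))` as `x → ∞`, for all `k`. -/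
def Symbol (m : ℝ) (f : ℝ → ℂ) : Prop := ∀ N, SymbolUpTo N m f

theorem rpow_isBigO_rpow {a b : ℝ} (h : a ≤ b) :
    (fun x : ℝ => x ^ a) =O[atTop] fun x : ℝ => x ^ b := by
  refine IsBigO.of_bound 1 ?_
  filter_upwards [eventually_ge_atTop 1] with x hx
  rw [Real.norm_of_nonneg (by positivity), Real.norm_of_nonneg (by positivity), one_mul]
  exact Real.rpow_le_rpow_of_exponent_le hx h

theorem rpow_isLittleO_rpow {a b : ℝ} (h : a < b) :
    (fun x : ℝ => x ^ a) =o[atTop] fun x : ℝ => x ^ b := by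
  refine (isLittleO_iff_tendsto' ?_).2 ?_
  · filter_upwards [eventually_gt_atTop 0] with x hx h0
    exact absurd h0 (Real.rpow_pos_of_pos hx b).ne'
  · refine (tendsto_rpow_neg_atTop (sub_pos.2 h)).congr' ?_
    filter_upwards [eventually_gt_atTop 0] with x hx
    rw [← Real.rpow_sub hx, neg_sub]

theorem rpow_mul_rpow_eventuallyEq (a b : ℝ) :
    (fun x : ℝ => x ^ a * x ^ b) =ᶠ[atTop] fun x : ℝ => x ^ (a + b) := by
  filter_upwards [eventually_gt_atTop 0] with x hx
  rw [Real.rpow_add hx]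

namespace SymbolUpTo

theorem isBigO {N : ℕ} {m : ℝ} {f : ℝ → ℂ} (h : SymbolUpTo N m f) :
    f =O[atTop] fun x : ℝ => x ^ m := by
  cases N with
  | zero => exact h
  | succ N => exact h.1

theorem congr {N : ℕ} {m : ℝ} {f g : ℝ → ℂ} (h : SymbolUpTo N m f) (hfg : f =ᶠ[atTop] g) :
    SymbolUpTo N m g := by
  induction N generalizing m f g with
  | zero => exact IsBigO.congr' h hfg EventuallyEq.rfl
  | succ N ih =>
    refine ⟨h.1.congr' hfg EventuallyEq.rfl, ?_, ih h.2.2 (deriv_eventuallyEq_atTop hfg)⟩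
    filter_upwards [h.2.1, eventually_eventually_nhds_atTop hfg] with x hx hx'
    exact hx.congr_of_eventuallyEq (EventuallyEq.symm hx')

theorem pred {N : ℕ} {m : ℝ} {f : ℝ → ℂ} (h : SymbolUpTo (N + 1) m f) : SymbolUpTo N m f := by
  induction N generalizing m f with
  | zero => exact h.1
  | succ N ih => exact ⟨h.1, h.2.1, ih h.2.2⟩

theorem mono {N : ℕ} {m m' : ℝ} {f : ℝ → ℂ} (h : SymbolUpTo N m f) (hm : m ≤ m') :
    SymbolUpTo N m' f := by
  induction N generalizing m m' f with
  | zero => exact IsBigO.trans h (rpow_isBigO_rpow hm)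
  | succ N ih => exact ⟨h.1.trans (rpow_isBigO_rpow hm), h.2.1, ih h.2.2 (by linarith)⟩

theorem add {N : ℕ} {m : ℝ} {f g : ℝ → ℂ} (hf : SymbolUpTo N m f) (hg : SymbolUpTo N m g) :
    SymbolUpTo N m (fun x => f x + g x) := by
  induction N generalizing m f g with
  | zero => exact IsBigO.add hf hg
  | succ N ih =>
    refine ⟨hf.1.add hg.1, ?_, (ih hf.2.2 hg.2.2).congr ?_⟩
    · filter_upwards [hf.2.1, hg.2.1] with x h1 h2 using h1.add h2
    · filter_upwards [hf.2.1, hg.2.1] with x h1 h2 using (deriv_fun_add h1 h2).symm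

theorem mul {N : ℕ} {a b : ℝ} {f g : ℝ → ℂ} (hf : SymbolUpTo N a f) (hg : SymbolUpTo N b g) :
    SymbolUpTo N (a + b) (fun x => f x * g x) := by
  induction N generalizing a b f g with
  | zero => exact (IsBigO.mul hf hg).congr' EventuallyEq.rfl (rpow_mul_rpow_eventuallyEq a b)
  | succ N ih =>
    refine ⟨(hf.1.mul hg.1).congr' EventuallyEq.rfl (rpow_mul_rpow_eventuallyEq a b), ?_, ?_⟩
    · filter_upwards [hf.2.1, hg.2.1] with x h1 h2 using h1.mul h2
    · refine SymbolUpTo.congr (add ((ih hf.2.2 hg.pred).mono (by linarith))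
        ((ih hf.pred hg.2.2).mono (by linarith))) ?_
      filter_upwards [hf.2.1, hg.2.1] with x h1 h2 using (deriv_fun_mul h1 h2).symm

theorem const (N : ℕ) (c : ℂ) : SymbolUpTo N 0 (fun _ => c) := by
  have key : ∀ N m, SymbolUpTo N m (fun _ => (0 : ℂ)) := by
    intro N
    induction N with
    | zero => exact fun m => isBigO_zero _ _
    | succ N ih =>
      refine fun m => ⟨isBigO_zero _ _, Eventually.of_forall fun x => by fun_prop, ?_⟩
      simpa using ih (m - 1)
  have h0 : (fun _ : ℝ => c) =O[atTop] fun x : ℝ => x ^ (0 : ℝ) := by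
    simpa using isBigO_const_const c (one_ne_zero' ℝ) atTop
  cases N with
  | zero => exact h0
  | succ N => exact ⟨h0, Eventually.of_forall fun x => by fun_prop, by simpa using key N _⟩

theorem const_mul {N : ℕ} {m : ℝ} {f : ℝ → ℂ} (c : ℂ) (h : SymbolUpTo N m f) :
    SymbolUpTo N m (fun x => c * f x) := by
  simpa using (const N c).mul h

/-- Since `(1/f)' = -f' (1/f)²`, the order-zero bound on `1/f` propagates to all derivatives. -/
theorem inv {N : ℕ} {m : ℝ} {f : ℝ → ℂ} (hf : SymbolUpTo N m f) (h0 : ∀ᶠ x in atTop, f x ≠ 0)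
    (hinv : (fun x => (f x)⁻¹) =O[atTop] fun x : ℝ => x ^ (-m)) :
    SymbolUpTo N (-m) (fun x => (f x)⁻¹) := by
  induction N with
  | zero => exact hinv
  | succ N ih =>
    refine ⟨hinv, ?_, ?_⟩
    · filter_upwards [hf.2.1, h0] with x h1 h2 using h1.inv h2
    · have := ((hf.2.2.mul ((ih hf.pred).mul (ih hf.pred))).const_mul (-1)).mono
        (m' := -m - 1) (by linarith)
      refine this.congr ?_
      filter_upwards [hf.2.1, h0] with x h1 h2
      rw [(h1.hasDerivAt.fun_inv h2).deriv]
      field_simp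

end SymbolUpTo

theorem hasDerivAt_ofReal_rpow {x : ℝ} (hx : 0 < x) (a : ℝ) :
    HasDerivAt (fun y : ℝ => ((y ^ a : ℝ) : ℂ)) ((a : ℂ) * ((x ^ (a - 1) : ℝ) : ℂ)) x := by
  have := (Real.hasDerivAt_rpow_const (x := x) (p := a) (Or.inl hx.ne')).ofReal_comp
  simpa using this

namespace Symbol

theorem isBigO {m : ℝ} {f : ℝ → ℂ} (h : Symbol m f) : f =O[atTop] fun x : ℝ => x ^ m := h 0

theorem differentiableAt {m : ℝ} {f : ℝ → ℂ} (h : Symbol m f) :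
    ∀ᶠ x in atTop, DifferentiableAt ℝ f x := (h 1).2.1

theorem deriv {m : ℝ} {f : ℝ → ℂ} (h : Symbol m f) : Symbol (m - 1) (deriv f) :=
  fun N => (h (N + 1)).2.2

theorem congr {m : ℝ} {f g : ℝ → ℂ} (h : Symbol m f) (hfg : f =ᶠ[atTop] g) : Symbol m g :=
  fun N => (h N).congr hfg

theorem mono {m m' : ℝ} {f : ℝ → ℂ} (h : Symbol m f) (hm : m ≤ m') : Symbol m' f :=
  fun N => (h N).mono hm

theorem add {m : ℝ} {f g : ℝ → ℂ} (hf : Symbol m f) (hg : Symbol m g) :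
    Symbol m (fun x => f x + g x) := fun N => (hf N).add (hg N)

theorem const_mul {m : ℝ} {f : ℝ → ℂ} (c : ℂ) (h : Symbol m f) : Symbol m (fun x => c * f x) :=
  fun N => (h N).const_mul c

theorem sub {m : ℝ} {f g : ℝ → ℂ} (hf : Symbol m f) (hg : Symbol m g) :
    Symbol m (fun x => f x - g x) := by
  simpa [sub_eq_add_neg] using hf.add (hg.const_mul (-1))

theorem mul {a b : ℝ} {f g : ℝ → ℂ} (hf : Symbol a f) (hg : Symbol b g) :
    Symbol (a + b) (fun x => f x * g x) := fun N => (hf N).mul (hg N)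

theorem inv {m : ℝ} {f : ℝ → ℂ} (hf : Symbol m f) (h0 : ∀ᶠ x in atTop, f x ≠ 0)
    (hinv : (fun x => (f x)⁻¹) =O[atTop] fun x : ℝ => x ^ (-m)) :
    Symbol (-m) (fun x => (f x)⁻¹) := fun N => (hf N).inv h0 hinv

theorem rpow (a : ℝ) : Symbol a (fun x : ℝ => ((x ^ a : ℝ) : ℂ)) := by
  have h (a : ℝ) : (fun x : ℝ => ((x ^ a : ℝ) : ℂ)) =O[atTop] fun x : ℝ => x ^ a :=
    IsBigO.of_bound 1 (Eventually.of_forall fun x => by simp)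
  intro N
  induction N generalizing a with
  | zero => exact h a
  | succ N ih =>
    refine ⟨h a, ?_, ((ih (a - 1)).const_mul a).congr ?_⟩
    · filter_upwards [eventually_gt_atTop 0] with x hx
        using (hasDerivAt_ofReal_rpow hx a).differentiableAt
    · filter_upwards [eventually_gt_atTop 0] with x hx using (hasDerivAt_ofReal_rpow hx a).deriv.symm

theorem const_mul_rpow (c : ℂ) {a m : ℝ} (h : a ≤ m) :
    Symbol m (fun x : ℝ => c * ((x ^ a : ℝ) : ℂ)) := ((rpow a).mono h).const_mul c

/-- A symbol with leading term `c x ^ m`, `c ≠ 0`, is eventually invertible. -/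
theorem elliptic {m r : ℝ} {c : ℂ} (hc : c ≠ 0) (hr : r < m) {f : ℝ → ℂ}
    (hf : Symbol m f)
    (h : (fun x : ℝ => f x - c * ((x ^ m : ℝ) : ℂ)) =O[atTop] fun x : ℝ => x ^ r) :
    (∀ᶠ x in atTop, f x ≠ 0) ∧ Symbol (-m) (fun x => (f x)⁻¹) := by
  have ho : (fun x : ℝ => x ^ r) =o[atTop] fun x : ℝ => x ^ m := rpow_isLittleO_rpow hr
  have hb : ∀ᶠ x in atTop, ‖c‖ / 2 * x ^ m ≤ ‖f x‖ := by
    filter_upwards [(h.trans_isLittleO ho).bound (half_pos (norm_pos_iff.2 hc)),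
      eventually_gt_atTop 0] with x hx hx0
    rw [Real.norm_of_nonneg (by positivity)] at hx
    have h1 : ‖c * ((x ^ m : ℝ) : ℂ)‖ = ‖c‖ * x ^ m := by
      rw [norm_mul, Complex.norm_of_nonneg (by positivity)]
    have h2 := norm_sub_norm_le (c * ((x ^ m : ℝ) : ℂ)) (c * ((x ^ m : ℝ) : ℂ) - f x)
    rw [sub_sub_cancel, norm_sub_rev (c * _), h1] at h2
    linarith
  have h0 : ∀ᶠ x in atTop, f x ≠ 0 := by
    filter_upwards [hb, eventually_gt_atTop 0] with x hx hx0
    have : 0 < ‖c‖ := norm_pos_iff.2 hc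
    exact norm_pos_iff.1 (lt_of_lt_of_le (by positivity) hx)
  refine ⟨h0, hf.inv h0 (IsBigO.of_bound (2 / ‖c‖) ?_)⟩
  filter_upwards [hb, eventually_gt_atTop 0] with x hx hx0
  have : 0 < ‖c‖ := norm_pos_iff.2 hc
  rw [Real.norm_of_nonneg (by positivity), norm_inv, Real.rpow_neg hx0.le]
  calc ‖f x‖⁻¹ ≤ (‖c‖ / 2 * x ^ m)⁻¹ := inv_anti₀ (by positivity) hx
    _ = _ := by field_simp

end Symbol

/-! ### First order linear equations near infinity -/

theorem norm_sub_le_of_hasDerivAt {f f' : ℝ → ℂ} {B B' : ℝ → ℝ} {a b : ℝ} (hab : a ≤ b)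
    (hf : ∀ x ∈ Set.Icc a b, HasDerivAt f (f' x) x)
    (hB : ∀ x ∈ Set.Icc a b, HasDerivAt B (B' x) x)
    (h : ∀ x ∈ Set.Icc a b, ‖f' x‖ ≤ B' x) : ‖f b - f a‖ ≤ B b - B a := by
  refine image_norm_le_of_norm_deriv_right_le_deriv_boundary' (f := fun x => f x - f a)
    (B := fun x => B x - B a) (f' := f') (B' := B') (a := a) (b := b) ?_ ?_ (by simp) ?_ ?_ ?_
    (Set.right_mem_Icc.2 hab)
  · exact fun x hx => ((hf x hx).sub_const _).continuousAt.continuousWithinAt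
  · exact fun x hx => ((hf x (Set.Ico_subset_Icc_self hx)).sub_const _).hasDerivWithinAt
  · exact fun x hx => ((hB x hx).sub_const _).continuousAt.continuousWithinAt
  · exact fun x hx => ((hB x (Set.Ico_subset_Icc_self hx)).sub_const _).hasDerivWithinAt
  · exact fun x hx => h x (Set.Ico_subset_Icc_self hx)

theorem hasDerivAt_norm_of_hasDerivAt_mul {F : ℝ → ℂ} {a : ℂ} {x : ℝ} (h : HasDerivAt F (a * F x) x)
    (h0 : F x ≠ 0) : HasDerivAt (fun y => ‖F y‖) (a.re * ‖F x‖) x := by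
  have h1 := h.norm_sq
  have h2 := h1.sqrt (by simpa using h0)
  simp only [Real.sqrt_sq (norm_nonneg _)] at h2
  convert h2 using 1
  have h3 : inner ℝ (F x) (a * F x) = a.re * ‖F x‖ ^ 2 := by
    rw [Complex.inner, mul_assoc, Complex.mul_conj, Complex.normSq_eq_norm_sq, Complex.re_mul_ofReal]
  have : 0 < ‖F x‖ := norm_pos_iff.2 h0
  rw [h3]
  field_simp

theorem eventually_rpow_dominates {c : ℝ} (hc : 0 < c) (k : ℝ) :
    ∀ᶠ x : ℝ in atTop, |k * x ^ (-(3 / 2) : ℝ)| ≤ c := by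
  have h := (tendsto_rpow_neg_atTop (y := 3 / 2) (by norm_num)).const_mul k
  rw [mul_zero] at h
  filter_upwards [h.abs.eventually_le_const (u := c) (by simpa using hc)] with x hx using hx

/-- With `x ^ (k + 1/2)` factored out, the bracket can be compared with a constant: for `|Re a| ≥
c√x` its first term has modulus at least `c`, and its second tends to `0`. -/
theorem hasDerivAt_norm_mul_rpow {F : ℝ → ℂ} {a : ℂ} {x : ℝ} (hx : 0 < x)
    (h : HasDerivAt F (a * F x) x) (h0 : F x ≠ 0) (k : ℝ) :
    HasDerivAt (fun y => ‖F y‖ * y ^ k)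
      (‖F x‖ * x ^ (k + 1 / 2) * (a.re * x ^ (-(1 / 2) : ℝ) + k * x ^ (-(3 / 2) : ℝ))) x := by
  refine ((hasDerivAt_norm_of_hasDerivAt_mul h h0).mul
    (Real.hasDerivAt_rpow_const (p := k) (Or.inl hx.ne'))).congr_deriv ?_
  have h1 : x ^ (k + 1 / 2) * x ^ (-(1 / 2) : ℝ) = x ^ k := by
    rw [← Real.rpow_add hx]; ring_nf
  have h2 : x ^ (k + 1 / 2) * x ^ (-(3 / 2) : ℝ) = x ^ (k - 1) := by
    rw [← Real.rpow_add hx]; ring_nf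
  rw [← h1, ← h2]
  ring

theorem le_mul_rpow_neg_half {c t x : ℝ} (hx : 0 < x) (h : c * x ^ (1 / 2 : ℝ) ≤ t) :
    c ≤ t * x ^ (-(1 / 2) : ℝ) := by
  have := mul_le_mul_of_nonneg_right h (Real.rpow_nonneg hx.le (-(1 / 2)))
  rwa [mul_assoc, ← Real.rpow_add hx, add_neg_cancel, Real.rpow_zero, mul_one] at this

/-- `F` is an integrating factor: `(F u)' = F g`. As `|F|` grows, `|F g|` is dominated by the
derivative of `K |F| x ^ (m - 1/2)`, and the initial value of `u` only affects `K`. -/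
theorem isBigO_of_linear_dominant {F u a g : ℝ → ℂ} {c m : ℝ} (hc : 0 < c)
    (hF : ∀ᶠ x in atTop, HasDerivAt F (a x * F x) x) (hF0 : ∀ᶠ x in atTop, F x ≠ 0)
    (hu : ∀ᶠ x in atTop, HasDerivAt u (-(a x * u x) + g x) x)
    (ha : ∀ᶠ x in atTop, c * x ^ (1 / 2 : ℝ) ≤ (a x).re)
    (hg : g =O[atTop] fun x : ℝ => x ^ m) :
    u =O[atTop] fun x : ℝ => x ^ (m - 1 / 2) := by
  obtain ⟨C, hC⟩ := hg.bound
  obtain ⟨X, hX⟩ := eventually_atTop.1 ((((hF.and hF0).and (hu.and ha)).and hC).and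
    ((eventually_rpow_dominates (half_pos hc) (m - 1 / 2)).and (eventually_gt_atTop 0)))
  -- The first entry makes the derivatives compare, the bracket being at least `c/2`; the second
  -- handles the starting point `X`.
  set K := max (2 * C / c) (‖u X‖ / X ^ (m - 1 / 2)) with hK
  refine IsBigO.of_bound K ?_
  filter_upwards [eventually_ge_atTop X] with x hx
  have hX0 : 0 < X := (hX X le_rfl).2.2
  have hx0 : 0 < x := hX0.trans_le hx
  have hKX : ‖F X * u X‖ ≤ K * (‖F X‖ * X ^ (m - 1 / 2)) := by
    rw [norm_mul, mul_left_comm]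
    gcongr
    rw [← div_le_iff₀ (by positivity)]
    exact le_max_right _ _
  have key := norm_sub_le_of_hasDerivAt (f := fun y => F y * u y) (f' := fun y => F y * g y)
    (B := fun y => K * (‖F y‖ * y ^ (m - 1 / 2))) (B' := fun y => K * (‖F y‖ * y ^ (m - 1 / 2 + 1 / 2) *
      ((a y).re * y ^ (-(1 / 2) : ℝ) + (m - 1 / 2) * y ^ (-(3 / 2) : ℝ)))) hx ?_ ?_ ?_
  · have h1 := norm_le_norm_add_norm_sub' (F x * u x) (F X * u X)
    have h2 : ‖F x‖ * ‖u x‖ ≤ ‖F x‖ * (K * x ^ (m - 1 / 2)) := by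
      rw [← norm_mul]
      linarith
    rw [Real.norm_of_nonneg (by positivity)]
    exact le_of_mul_le_mul_left h2 (norm_pos_iff.2 (hX x hx).1.1.1.2)
  · intro y hy
    obtain ⟨⟨⟨⟨h1, h2⟩, h3, h4⟩, h5⟩, h6, h7⟩ := hX y hy.1
    refine (h1.mul h3).congr_deriv ?_
    ring
  · intro y hy
    obtain ⟨⟨⟨⟨h1, h2⟩, h3, h4⟩, h5⟩, h6, h7⟩ := hX y hy.1
    exact (hasDerivAt_norm_mul_rpow h7 h1 h2 _).const_mul K
  · intro y hy
    obtain ⟨⟨⟨⟨h1, h2⟩, h3, h4⟩, h5⟩, h6, h7⟩ := hX y hy.1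
    have h8 := le_mul_rpow_neg_half h7 h4
    have h9 := (abs_le.1 h6).1
    rw [Real.norm_of_nonneg (by positivity)] at h5
    have hKc : C ≤ K * (c / 2) := by
      have := (div_le_iff₀ hc).1 (le_max_left (2 * C / c) (‖u X‖ / X ^ (m - 1 / 2)))
      linarith
    have hK0 : 0 ≤ K := le_trans (by positivity) (le_max_right _ _)
    rw [norm_mul, sub_add_cancel]
    calc ‖F y‖ * ‖g y‖ ≤ ‖F y‖ * (K * (c / 2) * y ^ m) := by gcongr; exact h5.trans (by gcongr)
      _ = K * (‖F y‖ * y ^ m * (c / 2)) := by ring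
      _ ≤ _ := by gcongr; linarith

/-- Now `|F|` decays and the homogeneous solution `1/F` grows. It is excluded by `hlim`, and `(F u)'
= F g` is integrated from `x` to infinity instead of from a fixed point. -/
theorem isBigO_of_linear_recessive {F u a g : ℝ → ℂ} {c m : ℝ} (hc : 0 < c)
    (hF : ∀ᶠ x in atTop, HasDerivAt F (a x * F x) x) (hF0 : ∀ᶠ x in atTop, F x ≠ 0)
    (hu : ∀ᶠ x in atTop, HasDerivAt u (-(a x * u x) + g x) x)
    (ha : ∀ᶠ x in atTop, (a x).re ≤ -(c * x ^ (1 / 2 : ℝ)))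
    (hg : g =O[atTop] fun x : ℝ => x ^ m) (hlim : Tendsto (fun x => F x * u x) atTop (𝓝 0)) :
    u =O[atTop] fun x : ℝ => x ^ (m - 1 / 2) := by
  obtain ⟨C, hC0, hC⟩ := hg.exists_nonneg
  obtain ⟨X, hX⟩ := eventually_atTop.1 ((((hF.and hF0).and (hu.and ha)).and hC.bound).and
    ((eventually_rpow_dominates (half_pos hc) (m - 1 / 2)).and (eventually_gt_atTop 0)))
  refine IsBigO.of_bound (2 * C / c) ?_
  filter_upwards [eventually_ge_atTop X] with x hx
  have hX0 : 0 < X := (hX X le_rfl).2.2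
  have hx0 : 0 < x := hX0.trans_le hx
  have key : ∀ Y ≥ x, ‖F Y * u Y - F x * u x‖ ≤ 2 * C / c * (‖F x‖ * x ^ (m - 1 / 2)) := by
    intro Y hY
    have hY0 : 0 < Y := hx0.trans_le hY
    refine (norm_sub_le_of_hasDerivAt (f := fun y => F y * u y) (f' := fun y => F y * g y)
      (B := fun y => -(2 * C / c) * (‖F y‖ * y ^ (m - 1 / 2)))
      (B' := fun y => -(2 * C / c) * (‖F y‖ * y ^ (m - 1 / 2 + 1 / 2) *
      ((a y).re * y ^ (-(1 / 2) : ℝ) + (m - 1 / 2) * y ^ (-(3 / 2) : ℝ)))) hY ?_ ?_ ?_).trans ?_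
    · intro y hy
      obtain ⟨⟨⟨⟨h1, h2⟩, h3, h4⟩, h5⟩, h6, h7⟩ := hX y (hx.trans hy.1)
      refine (h1.mul h3).congr_deriv ?_
      ring
    · intro y hy
      obtain ⟨⟨⟨⟨h1, h2⟩, h3, h4⟩, h5⟩, h6, h7⟩ := hX y (hx.trans hy.1)
      exact (hasDerivAt_norm_mul_rpow h7 h1 h2 _).const_mul _
    · intro y hy
      obtain ⟨⟨⟨⟨h1, h2⟩, h3, h4⟩, h5⟩, h6, h7⟩ := hX y (hx.trans hy.1)
      have h8 := le_mul_rpow_neg_half h7 (c := c) (t := -(a y).re) (by linarith)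
      have h9 := (abs_le.1 h6).2
      rw [Real.norm_of_nonneg (by positivity)] at h5
      rw [norm_mul, sub_add_cancel]
      calc ‖F y‖ * ‖g y‖ ≤ ‖F y‖ * (C * y ^ m) := by gcongr
        _ = 2 * C / c * (‖F y‖ * y ^ m * (c / 2)) := by field_simp
        _ ≤ 2 * C / c * (‖F y‖ * y ^ m * (-((a y).re * y ^ (-(1 / 2) : ℝ) +
              (m - 1 / 2) * y ^ (-(3 / 2) : ℝ)))) := by gcongr; linarith
        _ = _ := by ring
    · have : 0 ≤ 2 * C / c * (‖F Y‖ * Y ^ (m - 1 / 2)) := by positivity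
      linarith
  have h1 : ‖(0 : ℂ) - F x * u x‖ ≤ 2 * C / c * (‖F x‖ * x ^ (m - 1 / 2)) :=
    le_of_tendsto (hlim.sub_const _).norm (by
      filter_upwards [eventually_ge_atTop x] with Y hY using key Y hY)
  rw [zero_sub, norm_neg, norm_mul, mul_left_comm] at h1
  rw [Real.norm_of_nonneg (by positivity)]
  exact le_of_mul_le_mul_left h1 (norm_pos_iff.2 (hX x hx).1.1.1.2)

theorem isBigO_rpow_of_exponential_decay {F a : ℝ → ℂ} {c : ℝ} (hc : 0 < c)
    (hF : ∀ᶠ x in atTop, HasDerivAt F (a x * F x) x) (hF0 : ∀ᶠ x in atTop, F x ≠ 0)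
    (ha : ∀ᶠ x in atTop, (a x).re ≤ -(c * x ^ (1 / 2 : ℝ))) (k : ℝ) :
    F =O[atTop] fun x : ℝ => x ^ (-k) := by
  obtain ⟨X, hX⟩ := eventually_atTop.1 (((hF.and hF0).and ha).and
    ((eventually_rpow_dominates hc k).and (eventually_gt_atTop 0)))
  refine IsBigO.of_bound (‖F X‖ * X ^ k) ?_
  filter_upwards [eventually_ge_atTop X] with x hx
  have hx0 : 0 < x := (hX X le_rfl).2.2.trans_le hx
  -- Comparison with the zero function merely says that `‖F‖ y ^ k` is nonincreasing.
  have key := norm_sub_le_of_hasDerivAt (f := fun _ => 0) (f' := fun _ => 0)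
    (B := fun y => (-1) * (‖F y‖ * y ^ k)) (B' := fun y => (-1) * (‖F y‖ * y ^ (k + 1 / 2) *
      ((a y).re * y ^ (-(1 / 2) : ℝ) + k * y ^ (-(3 / 2) : ℝ)))) hx
      (fun y _ => hasDerivAt_const y _) ?_ ?_
  · rw [Real.norm_of_nonneg (by positivity), Real.rpow_neg hx0.le, ← div_eq_mul_inv,
      le_div_iff₀ (by positivity)]
    simp only [sub_self, norm_zero] at key
    linarith
  · intro y hy
    obtain ⟨⟨⟨h1, h2⟩, h4⟩, h6, h7⟩ := hX y hy.1
    exact (hasDerivAt_norm_mul_rpow h7 h1 h2 _).const_mul _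
  · intro y hy
    obtain ⟨⟨⟨h1, h2⟩, h4⟩, h6, h7⟩ := hX y hy.1
    have h8 := le_mul_rpow_neg_half h7 (c := c) (t := -(a y).re) (by linarith)
    have h9 := (abs_le.1 h6).2
    have h10 : 0 ≤ ‖F y‖ * y ^ (k + 1 / 2) := by positivity
    rw [norm_zero]
    nlinarith

/-- Solutions of `u' = - 2 v u + g` with `v ~ s √x` that grow at most polynomially are
`O (g / √x)`. -/
theorem isBigO_of_linear {F v u g : ℝ → ℂ} {s m M : ℝ} (hs : s ≠ 0)
    (hv : (fun x : ℝ => v x - s * ((x ^ (1 / 2 : ℝ) : ℝ) : ℂ)) =O[atTop] fun x : ℝ => x ^ (-1 : ℝ))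
    (hF : ∀ᶠ x in atTop, HasDerivAt F (2 * v x * F x) x) (hF0 : ∀ᶠ x in atTop, F x ≠ 0)
    (hu : ∀ᶠ x in atTop, HasDerivAt u (-(2 * v x * u x) + g x) x)
    (hg : g =O[atTop] fun x : ℝ => x ^ m) (hM : u =O[atTop] fun x : ℝ => x ^ M) :
    u =O[atTop] fun x : ℝ => x ^ (m - 1 / 2) := by
  have hre : ∀ᶠ x : ℝ in atTop,
      |(2 * v x).re - 2 * s * x ^ (1 / 2 : ℝ)| ≤ |s| * x ^ (1 / 2 : ℝ) := by
    have ho := hv.trans_isLittleO (rpow_isLittleO_rpow (b := 1 / 2) (by norm_num))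
    filter_upwards [ho.bound (half_pos (abs_pos.2 hs)), eventually_gt_atTop 0] with x hx hx0
    rw [Real.norm_of_nonneg (by positivity)] at hx
    have h1 := (Complex.abs_re_le_norm _).trans hx
    have h2 : (v x - s * ((x ^ (1 / 2 : ℝ) : ℝ) : ℂ)).re = (v x).re - s * x ^ (1 / 2 : ℝ) := by
      rw [← Complex.ofReal_mul, Complex.sub_re, Complex.ofReal_re]
    rw [h2] at h1
    have h3 : (2 * v x).re - 2 * s * x ^ (1 / 2 : ℝ) = 2 * ((v x).re - s * x ^ (1 / 2 : ℝ)) := by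
      simp; ring
    rw [h3, abs_mul, abs_two]
    linarith
  rcases lt_or_gt_of_ne hs with h | h
  · have ha : ∀ᶠ x : ℝ in atTop, (2 * v x).re ≤ -(-s * x ^ (1 / 2 : ℝ)) := by
      filter_upwards [hre] with x hx
      rw [abs_of_neg h] at hx
      linarith [(abs_le.1 hx).2]
    refine isBigO_of_linear_recessive (neg_pos.2 h) hF hF0 hu ha hg ?_
    have h1 := (isBigO_rpow_of_exponential_decay (neg_pos.2 h) hF hF0 ha (M + 1)).mul hM
    refine (h1.congr' EventuallyEq.rfl (rpow_mul_rpow_eventuallyEq _ _)).trans_tendsto ?_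
    have := tendsto_rpow_neg_atTop (y := 1) one_pos
    convert this using 2
    ring_nf
  · refine isBigO_of_linear_dominant h hF hF0 hu ?_ hg
    filter_upwards [hre] with x hx
    rw [abs_of_pos h] at hx
    linarith [(abs_le.1 hx).1]

/-- Differentiating the equation shows that `u'` solves one of the same form, with `g` replaced by
`g' - 2v'u`, of order `m - 1`. The equation itself supplies the polynomial bound on `u'`. -/
theorem SymbolUpTo.of_linear {F v u g : ℝ → ℂ} {s m M : ℝ} {N : ℕ} (hs : s ≠ 0)
    (hv : (fun x : ℝ => v x - s * ((x ^ (1 / 2 : ℝ) : ℝ) : ℂ)) =O[atTop] fun x : ℝ => x ^ (-1 : ℝ))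
    (hF : ∀ᶠ x in atTop, HasDerivAt F (2 * v x * F x) x) (hF0 : ∀ᶠ x in atTop, F x ≠ 0)
    (hvN : SymbolUpTo N (1 / 2) v)
    (hu : ∀ᶠ x in atTop, HasDerivAt u (-(2 * v x * u x) + g x) x)
    (hg : SymbolUpTo N m g) (hM : u =O[atTop] fun x : ℝ => x ^ M) :
    SymbolUpTo N (m - 1 / 2) u := by
  induction N generalizing m M u g with
  | zero => exact isBigO_of_linear hs hv hF hF0 hu hg hM
  | succ N ih =>
    have hu' : deriv u =ᶠ[atTop] fun x => -(2 * v x * u x) + g x := by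
      filter_upwards [hu] with x hx using hx.deriv
    have huN := ih hvN.pred hu hg.pred hM
    refine ⟨huN.isBigO, hu.mono fun x hx => hx.differentiableAt, ?_⟩
    have hgr : SymbolUpTo N (m - 1) (fun x => -2 * (deriv v x * u x) + deriv g x) :=
      (((hvN.2.2.mul huN).const_mul (-2)).mono (by linarith)).add hg.2.2
    have hM' : deriv u =O[atTop] fun x : ℝ => x ^ m := by
      refine IsBigO.congr' (f₁ := fun x => -2 * (v x * u x) + g x) ?_ ?_ EventuallyEq.rfl
      · have h := (hvN.isBigO.mul huN.isBigO).congr' EventuallyEq.rfl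
          (rpow_mul_rpow_eventuallyEq _ _)
        exact ((h.trans (rpow_isBigO_rpow (by linarith))).const_mul_left (-2)).add hg.isBigO
      · filter_upwards [hu'] with x hx
        rw [hx]; ring
    refine (ih hvN.pred ?_ hgr hM').mono (by linarith)
    filter_upwards [hvN.2.1, hg.2.1, hu, hu', eventually_eventually_nhds_atTop hu']
      with x h1 h2 h3 h4 h5
    have h6 := ((((h1.hasDerivAt.const_mul 2).mul h3).neg).add h2.hasDerivAt).congr_of_eventuallyEq h5
    refine h6.congr_deriv ?_
    rw [h4]
    ring

/-! ### Expansion of the logarithmic derivative of a solution of `ψ'' = x ψ / 2` -/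

/-- The power `x ^ a`, as a complex number. -/
noncomputable def pw (a x : ℝ) : ℂ := ((x ^ a : ℝ) : ℂ)

theorem pw_mul_pw (a b : ℝ) {x : ℝ} (hx : 0 < x) : pw a x * pw b x = pw (a + b) x := by
  rw [pw, pw, pw, ← Complex.ofReal_mul, Real.rpow_add hx]

/-- Turns half-integer powers into integer powers of `√x`, so that identities between expansions
become polynomial ones. -/
theorem pw_eq_zpow {a x : ℝ} (k : ℤ) (hx : 0 < x) (h : a = k / 2) :
    pw a x = pw (1 / 2) x ^ k := by
  rw [pw, pw, ← Complex.ofReal_zpow, ← Real.rpow_intCast, ← Real.rpow_mul hx.le, h]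
  ring_nf

theorem pw_ne_zero (a : ℝ) {x : ℝ} (hx : 0 < x) : pw a x ≠ 0 :=
  Complex.ofReal_ne_zero.2 (Real.rpow_pos_of_pos hx a).ne'

theorem pw_half_sq {x : ℝ} (hx : 0 < x) : pw (1 / 2) x ^ 2 = x := by
  rw [sq, pw_mul_pw _ _ hx, pw]
  norm_num

theorem hasDerivAt_pw (a : ℝ) {x : ℝ} (hx : 0 < x) : HasDerivAt (pw a) (a * pw (a - 1) x) x :=
  hasDerivAt_ofReal_rpow hx a

theorem Symbol.const_mul_pw (c : ℂ) {a m : ℝ} (h : a ≤ m) : Symbol m (fun x => c * pw a x) :=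
  Symbol.const_mul_rpow c h

/-- If `v = ψ' / ψ` has the sign of `s` (and `ψ` is bounded for `s < 0`), then `v ~ s √x`. -/
theorem logDeriv_sub_isBigO {s : ℝ} (hs : s ^ 2 = 1 / 2) {ψ ψ' : ℝ → ℂ}
    (h : ∀ x, HasDerivAt ψ (ψ' x) x) (h' : ∀ x, HasDerivAt ψ' (x / 2 * ψ x) x)
    (h0 : ∀ᶠ x in atTop, ψ x ≠ 0)
    (hsgn : (0 < s ∧ ∀ᶠ x in atTop, 0 ≤ (ψ' x / ψ x).re) ∨
      (s < 0 ∧ (∀ᶠ x in atTop, (ψ' x / ψ x).re ≤ 0) ∧ ψ =O[atTop] (fun _ => (1 : ℝ)) ∧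
        ψ' =O[atTop] (fun _ => (1 : ℝ)))) :
    (fun x : ℝ => ψ' x / ψ x - s * pw (1 / 2) x) =O[atTop] fun x : ℝ => x ^ (-1 : ℝ) := by
  -- As `x/2 = s²x`, the Riccati equation factors: `u = v - s√x` satisfies `u' = -(v + s√x) u -
  -- s/(2√x)`, with integrating factor `ψ e`. The sign of `Re v` bounds `Re a` by `s√x` on the
  -- correct side.
  set a : ℝ → ℂ := fun x => ψ' x / ψ x + s * pw (1 / 2) x with ha
  set e : ℝ → ℂ := fun x => Complex.exp ((2 * s / 3 : ℂ) * pw (3 / 2) x) with he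
  have hsC : (s : ℂ) ^ 2 = 1 / 2 := by rw [← Complex.ofReal_pow, hs]; norm_num
  have hF : ∀ᶠ x in atTop, HasDerivAt (fun x => ψ x * e x) (a x * (ψ x * e x)) x := by
    filter_upwards [h0, eventually_gt_atTop 0] with x hx hx0
    refine ((h x).mul (((hasDerivAt_pw (3 / 2) hx0).const_mul (2 * s / 3 : ℂ)).cexp)).congr_deriv ?_
    have h1 : (3 / 2 - 1 : ℝ) = 1 / 2 := by norm_num
    rw [h1]
    simp only [ha, he]
    push_cast
    field_simp
  have hF0 : ∀ᶠ x in atTop, ψ x * e x ≠ 0 := by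
    filter_upwards [h0] with x hx using mul_ne_zero hx (Complex.exp_ne_zero _)
  have hu : ∀ᶠ x in atTop, HasDerivAt (fun x : ℝ => ψ' x / ψ x - s * pw (1 / 2) x)
      (-(a x * (ψ' x / ψ x - s * pw (1 / 2) x)) + -(s / 2 : ℂ) * pw (-(1 / 2)) x) x := by
    filter_upwards [h0, eventually_gt_atTop 0] with x hx hx0
    refine (((h' x).fun_div (h x) hx).sub
      ((hasDerivAt_pw (1 / 2) hx0).const_mul (s : ℂ))).congr_deriv ?_
    have h1 : (1 / 2 - 1 : ℝ) = -(1 / 2) := by norm_num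
    rw [h1]
    simp only [ha]
    have h2 := pw_half_sq hx0
    push_cast
    field_simp
    rw [show (x : ℂ) = pw (1 / 2) x ^ 2 from h2.symm]
    linear_combination (-2 * pw (1 / 2) x ^ 2 * ψ x ^ 2) * hsC
  have hre (x : ℝ) : (a x).re = (ψ' x / ψ x).re + s * x ^ (1 / 2 : ℝ) := by
    simp only [ha, pw, ← Complex.ofReal_mul, Complex.add_re, Complex.ofReal_re]
  have hg := (Symbol.const_mul_pw (-(s / 2 : ℂ)) (le_refl (-(1 / 2) : ℝ))).isBigO
  have hm : (-(1 / 2) - 1 / 2 : ℝ) = -1 := by norm_num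
  rw [← hm]
  rcases hsgn with ⟨h1, h2⟩ | ⟨h1, h2, h3, h4⟩
  · refine isBigO_of_linear_dominant h1 hF hF0 hu ?_ hg
    filter_upwards [h2] with x hx
    rw [hre]
    linarith
  · refine isBigO_of_linear_recessive (neg_pos.2 h1) hF hF0 hu ?_ hg ?_
    · filter_upwards [h2] with x hx
      rw [hre]
      linarith
    · have hcs : 0 < -(2 * s / 3) := by linarith
      have hlim (k : ℝ) : Tendsto (fun x : ℝ =>
          x ^ k * Real.exp (-(-(2 * s / 3)) * x ^ (3 / 2 : ℝ))) atTop (𝓝 0) := by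
        have h5 := (tendsto_rpow_mul_exp_neg_mul_atTop_nhds_zero (k / (3 / 2)) _ hcs).comp
          (tendsto_rpow_atTop (y := 3 / 2) (by norm_num))
        refine h5.congr' ?_
        filter_upwards [eventually_gt_atTop 0] with x hx
        simp only [Function.comp]
        rw [← Real.rpow_mul hx.le]
        congr 2
        ring
      have hen (x : ℝ) : ‖e x‖ = Real.exp (-(-(2 * s / 3)) * x ^ (3 / 2 : ℝ)) := by
        simp only [he, pw]
        rw [Complex.norm_exp, neg_neg]
        congr 1
        have : (2 * s / 3 : ℂ) * ((x ^ (3 / 2 : ℝ) : ℝ) : ℂ) =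
          ((2 * s / 3 * x ^ (3 / 2 : ℝ) : ℝ) : ℂ) := by push_cast; ring
        rw [this, Complex.ofReal_re]
      -- The product equals `(ψ' - s√x ψ) e`: the bounds on `ψ` and `ψ'` leave a factor `O(√x)`, and
      -- `e` decays faster than any power.
      have hbig : (fun x => ψ x * e x * (ψ' x / ψ x - s * pw (1 / 2) x)) =O[atTop]
          fun x : ℝ => x ^ (1 / 2 : ℝ) * Real.exp (-(-(2 * s / 3)) * x ^ (3 / 2 : ℝ)) := by
        have h5 : (fun x => ψ' x - s * pw (1 / 2) x * ψ x) =O[atTop]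
            fun x : ℝ => x ^ (1 / 2 : ℝ) := by
          have h6 : (fun _ : ℝ => (1 : ℝ)) =O[atTop] fun x : ℝ => x ^ (1 / 2 : ℝ) := by
            simpa using rpow_isBigO_rpow (a := 0) (b := 1 / 2) (by norm_num)
          refine (h4.trans h6).sub ?_
          simpa using (Symbol.const_mul_pw (s : ℂ) (le_refl (1 / 2 : ℝ))).isBigO.mul h3
        refine IsBigO.congr' (h5.mul (IsBigO.of_norm_left (IsBigO.of_bound' (f := fun x => ‖e x‖)
          (Eventually.of_forall fun x => ?_)))) ?_ EventuallyEq.rfl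
        · rw [hen]
        · filter_upwards [h0] with x hx
          field_simp
      exact hbig.trans_tendsto (hlim _)

/-- The expansion of `σ_n (- x)` up to sign. -/
noncomputable def expansion (s n : ℂ) (x : ℝ) : ℂ :=
  s * n * pw (1 / 2) x + -(n ^ 2 / 4) * pw (-1) x + -(s * n * (4 * n ^ 2 + 1) / 16) * pw (-5 / 2) x

/-- The derivative of `expansion`. -/
noncomputable def expansionDeriv (s n : ℂ) (x : ℝ) : ℂ :=
  s * n / 2 * pw (-1 / 2) x + n ^ 2 / 4 * pw (-2) x +
    5 * s * n * (4 * n ^ 2 + 1) / 32 * pw (-7 / 2) x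

theorem hasDerivAt_expansion (s n : ℂ) {x : ℝ} (hx : 0 < x) :
    HasDerivAt (expansion s n) (expansionDeriv s n x) x := by
  refine ((((hasDerivAt_pw (1 / 2) hx).const_mul _).add ((hasDerivAt_pw (-1) hx).const_mul _)).add
    ((hasDerivAt_pw (-5 / 2) hx).const_mul _)).congr_deriv ?_
  rw [expansionDeriv]
  norm_num
  ring

theorem symbol_expansion (s n : ℂ) : Symbol (1 / 2) (expansion s n) :=
  ((Symbol.const_mul_pw _ le_rfl).add (Symbol.const_mul_pw _ (by norm_num))).add
    (Symbol.const_mul_pw _ (by norm_num))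

/-- Differentiating the Riccati equation, `w = v'` solves `w' = -2vw + 1/2`, linear with integrating
factor `ψ²`. Thus control of `N` derivatives of `v` yields control of `N` derivatives of `v'`. -/
theorem symbol_logDeriv {s : ℝ} (hs : s ^ 2 = 1 / 2) {ψ ψ' : ℝ → ℂ}
    (h : ∀ x, HasDerivAt ψ (ψ' x) x) (h' : ∀ x, HasDerivAt ψ' (x / 2 * ψ x) x)
    (h0 : ∀ᶠ x in atTop, ψ x ≠ 0)
    (hv : (fun x : ℝ => ψ' x / ψ x - s * pw (1 / 2) x) =O[atTop] fun x : ℝ => x ^ (-1 : ℝ)) :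
    Symbol (1 / 2) (fun x => ψ' x / ψ x) := by
  set v : ℝ → ℂ := fun x => ψ' x / ψ x with hvdef
  have hs0 : s ≠ 0 := by rintro rfl; norm_num at hs
  have hvO : v =O[atTop] fun x : ℝ => x ^ (1 / 2 : ℝ) := by
    have h1 := (hv.trans (rpow_isBigO_rpow (b := 1 / 2) (by norm_num))).add
      (Symbol.const_mul_pw (s : ℂ) (le_refl (1 / 2 : ℝ))).isBigO
    simpa using h1
  have hvd : ∀ᶠ x in atTop, HasDerivAt v (x / 2 - v x ^ 2) x := by
    filter_upwards [h0] with x hx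
    refine ((h' x).fun_div (h x) hx).congr_deriv ?_
    simp only [hvdef]
    field_simp
  have hdv : deriv v =ᶠ[atTop] fun x => (x : ℂ) / 2 - v x ^ 2 := hvd.mono fun x hx => hx.deriv
  have hF : ∀ᶠ x in atTop, HasDerivAt (fun x => ψ x * ψ x) (2 * v x * (ψ x * ψ x)) x := by
    filter_upwards [h0] with x hx
    refine ((h x).mul (h x)).congr_deriv ?_
    simp only [hvdef]
    field_simp
    ring
  have hF0 : ∀ᶠ x in atTop, ψ x * ψ x ≠ 0 := h0.mono fun x hx => mul_ne_zero hx hx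
  have hu : ∀ᶠ x in atTop, HasDerivAt (fun x : ℝ => (x : ℂ) / 2 - v x ^ 2)
      (-(2 * v x * ((x : ℂ) / 2 - v x ^ 2)) + 1 / 2) x := by
    filter_upwards [hvd] with x hx
    refine (((hasDerivAt_id x).ofReal_comp.div_const 2).sub (hx.pow 2)).congr_deriv ?_
    simp
    ring
  have hM : (fun x : ℝ => (x : ℂ) / 2 - v x ^ 2) =O[atTop] fun x : ℝ => x ^ (1 : ℝ) := by
    have h1 : (fun x => v x ^ 2) =O[atTop] fun x : ℝ => x ^ (1 : ℝ) := by
      have := (hvO.mul hvO).congr' EventuallyEq.rfl (rpow_mul_rpow_eventuallyEq _ _)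
      norm_num at this
      simpa [sq] using this
    refine IsBigO.sub ?_ h1
    refine (Symbol.const_mul_pw (1 / 2) (le_refl (1 : ℝ))).isBigO.congr_left fun x => ?_
    simp [pw]
    ring
  intro N
  induction N with
  | zero => exact hvO
  | succ N ih =>
    refine ⟨hvO, hvd.mono fun x hx => hx.differentiableAt, ?_⟩
    have := SymbolUpTo.of_linear hs0 hv hF hF0 ih hu (SymbolUpTo.const N (1 / 2)) hM
    exact (this.mono (by norm_num)).congr hdv.symm

/-- Write `e` for the expansion, `E = v - e`, `P = v + e`. The Riccati equation becomes `E = (R -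
E')/P` with `P ~ 2s√x`, so each use of it improves the order of `E` by `3/2` until `R` limits it. -/
theorem symbol_logDeriv_sub_expansion {s : ℝ} (hs : s ^ 2 = 1 / 2) {ψ ψ' : ℝ → ℂ}
    (h : ∀ x, HasDerivAt ψ (ψ' x) x) (h' : ∀ x, HasDerivAt ψ' (x / 2 * ψ x) x)
    (h0 : ∀ᶠ x in atTop, ψ x ≠ 0)
    (hv : (fun x : ℝ => ψ' x / ψ x - s * pw (1 / 2) x) =O[atTop] fun x : ℝ => x ^ (-1 : ℝ)) :
    Symbol (-4) (fun x => ψ' x / ψ x - expansion s 1 x) := by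
  have hsC : (s : ℂ) ^ 2 = 1 / 2 := by rw [← Complex.ofReal_pow, hs]; norm_num
  have hs0 : (s : ℂ) ≠ 0 := by rintro h; rw [h] at hsC; norm_num at hsC
  have hvS := symbol_logDeriv hs h h' h0 hv
  set v : ℝ → ℂ := fun x => ψ' x / ψ x with hvdef
  have hvd : ∀ᶠ x in atTop, HasDerivAt v (x / 2 - v x ^ 2) x := by
    filter_upwards [h0] with x hx
    refine ((h' x).fun_div (h x) hx).congr_deriv ?_
    simp only [hvdef]
    field_simp
  set E : ℝ → ℂ := fun x => v x - expansion s 1 x with hE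
  have hES : Symbol (1 / 2) E := hvS.sub (symbol_expansion _ _)
  set P : ℝ → ℂ := fun x => v x + expansion s 1 x with hP
  have hPS : Symbol (1 / 2) P := hvS.add (symbol_expansion _ _)
  have hPe := hPS.elliptic (c := 2 * s) (r := -1) (mul_ne_zero two_ne_zero hs0) (by norm_num) (by
    have h1 : (fun x => -(1 / 4 : ℂ) * pw (-1) x + -(5 * s / 16 : ℂ) * pw (-5 / 2) x) =O[atTop]
        fun x : ℝ => x ^ (-1 : ℝ) := ((Symbol.const_mul_pw _ le_rfl).add
          (Symbol.const_mul_pw _ (by norm_num))).isBigO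
    refine (hv.add h1).congr_left fun x => ?_
    simp only [hP, hvdef, expansion]
    change _ = _ - 2 * (s : ℂ) * pw (1 / 2) x
    ring)
  -- The residual `x/2 - e² - e'` of the truncated expansion in the Riccati equation.
  set R : ℝ → ℂ := fun x => -(15 * s / 16 : ℂ) * pw (-7 / 2) x + -(25 / 512 : ℂ) * pw (-5) x with hR
  have hRS : Symbol (-7 / 2) R :=
    (Symbol.const_mul_pw _ le_rfl).add (Symbol.const_mul_pw _ (by norm_num))
  have hEeq : E =ᶠ[atTop] fun x => (R x - deriv E x) * (P x)⁻¹ := by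
    filter_upwards [hvd, hPe.1, eventually_gt_atTop 0] with x h1 h2 hx
    have h3 : deriv E x = _ := (h1.sub (hasDerivAt_expansion s 1 hx)).deriv
    rw [h3, eq_mul_inv_iff_mul_eq₀ h2]
    simp only [hE, hR, hP, expansion, expansionDeriv]
    rw [pw_eq_zpow (-2) hx (by norm_num : (-1 : ℝ) = _),
      pw_eq_zpow (-5) hx (by norm_num : (-5 / 2 : ℝ) = _),
      pw_eq_zpow (-1) hx (by norm_num : (-1 / 2 : ℝ) = _),
      pw_eq_zpow (-4) hx (by norm_num : (-2 : ℝ) = _),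
      pw_eq_zpow (-7) hx (by norm_num : (-7 / 2 : ℝ) = _),
      pw_eq_zpow (-10) hx (by norm_num : (-5 : ℝ) = _), ← pw_half_sq hx]
    have h3 := pw_ne_zero (1 / 2) hx
    have h4 := mul_inv_cancel₀ h3
    simp only [zpow_neg, zpow_ofNat, ← inv_pow]
    generalize (pw (1 / 2) x)⁻¹ = r at *
    generalize pw (1 / 2) x = q at *
    linear_combination (-(q ^ 2 - 5 / 8 * r ^ 4 + 25 / 256 * r ^ 10)) * hsC +
      (s / 2 * r + 5 * s ^ 2 / 8 * r ^ 4) * h4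
  -- Three applications take the order through `1/2`, `-1`, `-5/2`, `-4`.
  have hstep : ∀ m : ℝ, Symbol m E → Symbol (max (-7 / 2) (m - 1) + -(1 / 2)) E := fun m hm =>
    (((hRS.mono (le_max_left _ _)).sub (hm.deriv.mono (le_max_right _ _))).mul hPe.2).congr hEeq.symm
  have h1 := hstep _ hES
  norm_num at h1
  have h2 := hstep _ h1
  norm_num at h2
  have h3 := hstep _ h2
  norm_num at h3
  exact h3

/-! ### Propagation of the expansion along the Toda recursion. -/

theorem deriv_eventuallyEq_of_symbol_sub {m : ℝ} {s n : ℂ} {L : ℝ → ℂ}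
    (h : Symbol m (fun x => L x - expansion s n x)) :
    deriv (fun x => L x - expansion s n x) =ᶠ[atTop] fun x => deriv L x - expansionDeriv s n x := by
  filter_upwards [h.differentiableAt, eventually_gt_atTop 0] with x h1 hx
  have h2 := hasDerivAt_expansion s n hx
  have h3 : DifferentiableAt ℝ L x := by
    have := h1.fun_add h2.differentiableAt
    simpa using this
  exact (h3.hasDerivAt.sub h2).deriv

theorem hasDerivAt_expansionDeriv (s n : ℂ) {x : ℝ} (hx : 0 < x) :
    HasDerivAt (expansionDeriv s n) (-(s * n / 4) * pw (-3 / 2) x + -(n ^ 2 / 2) * pw (-3) x +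
      -(35 * s * n * (4 * n ^ 2 + 1) / 64) * pw (-9 / 2) x) x := by
  refine ((((hasDerivAt_pw (-1 / 2) hx).const_mul _).add ((hasDerivAt_pw (-2) hx).const_mul _)).add
    ((hasDerivAt_pw (-7 / 2) hx).const_mul _)).congr_deriv ?_
  norm_num
  ring

/-- The expansion is propagated by the Toda recursion `L₂ = 2 L₁ - L₀ + L₁'' / L₁'`. -/
theorem symbol_toda {s n : ℂ} (hs : s ^ 2 = 1 / 2) (hn : n ≠ 0) {L₀ L₁ : ℝ → ℂ}
    (h₀ : Symbol (-4) (fun x => L₀ x - expansion s (n - 1) x))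
    (h₁ : Symbol (-4) (fun x => L₁ x - expansion s n x)) :
    (∀ᶠ x in atTop, deriv L₁ x ≠ 0) ∧
    Symbol (-4) (fun x => 2 * L₁ x - L₀ x + deriv (deriv L₁) x / deriv L₁ x -
      expansion s (n + 1) x) := by
  have hs0 : s ≠ 0 := by rintro rfl; norm_num at hs
  set ρ : ℝ → ℂ := deriv fun x => L₁ x - expansion s n x with hρ
  have hρS : Symbol (-5) ρ := by have := h₁.deriv; norm_num at this; exact this
  have hρ'S : Symbol (-6) (deriv ρ) := by have := hρS.deriv; norm_num at this; exact this
  have hG : deriv L₁ =ᶠ[atTop] fun x => ρ x + expansionDeriv s n x := by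
    filter_upwards [deriv_eventuallyEq_of_symbol_sub h₁] with x hx
    rw [hρ, hx]
    ring
  have hG' : deriv (deriv L₁) =ᶠ[atTop] fun x => deriv ρ x + (-(s * n / 4) * pw (-3 / 2) x +
      -(n ^ 2 / 2) * pw (-3) x + -(35 * s * n * (4 * n ^ 2 + 1) / 64) * pw (-9 / 2) x) := by
    filter_upwards [deriv_eventuallyEq_atTop hG, hρS.differentiableAt, eventually_gt_atTop 0]
      with x h1 h2 hx
    rw [h1]
    exact (h2.hasDerivAt.add (hasDerivAt_expansionDeriv s n hx)).deriv
  have hlow : Symbol (-2) (fun x => ρ x + (n ^ 2 / 4 * pw (-2) x +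
      5 * s * n * (4 * n ^ 2 + 1) / 32 * pw (-7 / 2) x)) :=
    (hρS.mono (by norm_num)).add ((Symbol.const_mul_pw _ le_rfl).add
      (Symbol.const_mul_pw _ (by norm_num)))
  have hlead : Symbol (-1 / 2) (fun x => s * n / 2 * pw (-1 / 2) x) := Symbol.const_mul_pw _ le_rfl
  have hGS : Symbol (-1 / 2) (deriv L₁) := by
    refine (hlead.add (hlow.mono (by norm_num))).congr ?_
    filter_upwards [hG] with x hx
    rw [hx, expansionDeriv]
    ring
  have hell := hGS.elliptic (c := s * n / 2) (r := -2)
    (div_ne_zero (mul_ne_zero hs0 hn) two_ne_zero) (by norm_num) (by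
      refine hlow.isBigO.congr' ?_ EventuallyEq.rfl
      filter_upwards [hG] with x hx
      rw [hx, expansionDeriv]
      change _ = _ - s * n / 2 * pw (-1 / 2) x
      ring)
  refine ⟨hell.1, ?_⟩
  -- `q` is exactly the second difference in `n` of `expansion s n`, so it remains to show that
  -- `L₁''/L₁'` equals `q` up to order `-4`.
  set q : ℝ → ℂ := fun x => -(1 / 2) * pw (-1) x + -(3 * n * s / 2) * pw (-5 / 2) x with hq
  have hqS : Symbol (-1) q := (Symbol.const_mul_pw _ le_rfl).add (Symbol.const_mul_pw _ (by norm_num))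
  -- Order `-9/2` suffices, since `1/L₁'` has order `1/2`.
  have hD : Symbol (-9 / 2) (fun x => deriv (deriv L₁) x - deriv L₁ x * q x) := by
    have h1 : Symbol (-9 / 2) (fun x => deriv ρ x - ρ x * q x) :=
      (hρ'S.mono (by norm_num)).sub ((hρS.mul hqS).mono (by norm_num))
    have h2 : Symbol (-9 / 2) (fun x =>
        (-(30 * s * n * (4 * n ^ 2 + 1) / 64) + 3 * n ^ 3 * s / 8) * pw (-9 / 2) x +
        (15 * s ^ 2 * n ^ 2 * (4 * n ^ 2 + 1) / 64) * pw (-6) x) :=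
      (Symbol.const_mul_pw _ le_rfl).add (Symbol.const_mul_pw _ (by norm_num))
    refine (h1.add h2).congr ?_
    filter_upwards [hG, hG', eventually_gt_atTop 0] with x h3 h4 hx
    rw [h3, h4]
    simp only [hq, expansionDeriv]
    rw [pw_eq_zpow (-2) hx (by norm_num : (-1 : ℝ) = _),
      pw_eq_zpow (-5) hx (by norm_num : (-5 / 2 : ℝ) = _),
      pw_eq_zpow (-1) hx (by norm_num : (-1 / 2 : ℝ) = _),
      pw_eq_zpow (-4) hx (by norm_num : (-2 : ℝ) = _),
      pw_eq_zpow (-7) hx (by norm_num : (-7 / 2 : ℝ) = _),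
      pw_eq_zpow (-3) hx (by norm_num : (-3 / 2 : ℝ) = _),
      pw_eq_zpow (-6) hx (by norm_num : (-3 : ℝ) = _),
      pw_eq_zpow (-9) hx (by norm_num : (-9 / 2 : ℝ) = _),
      pw_eq_zpow (-12) hx (by norm_num : (-6 : ℝ) = _)]
    simp only [zpow_neg, zpow_ofNat, ← inv_pow]
    generalize (pw (1 / 2) x)⁻¹ = r
    linear_combination (-(3 * n ^ 2 / 4) * r ^ 6) * hs
  have hfin : Symbol (-4) (fun x => (deriv (deriv L₁) x - deriv L₁ x * q x) * (deriv L₁ x)⁻¹) :=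
    (hD.mul hell.2).mono (by norm_num)
  refine (((h₁.const_mul 2).sub h₀).add hfin).congr ?_
  filter_upwards [hell.1] with x hx
  have h5 : (deriv (deriv L₁) x - deriv L₁ x * q x) * (deriv L₁ x)⁻¹ =
      deriv (deriv L₁) x / deriv L₁ x - q x := by field_simp
  rw [h5]
  simp only [hq, expansion]
  ring

/-! ### Hankel determinants of derivatives and the Toda equation -/

/-- The determinant of the matrix of the `h (r i + c j)`. -/
noncomputable def indexedDet {ι : Type*} [Fintype ι] [DecidableEq ι] (h : ℕ → ℂ) (r c : ι → ℕ) : ℂ :=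
  (Matrix.of fun i j => h (r i + c j)).det

section indexedDet

variable {ι : Type*} [Fintype ι] [DecidableEq ι]

theorem indexedDet_comm (h : ℕ → ℂ) (r c : ι → ℕ) : indexedDet h r c = indexedDet h c r := by
  rw [indexedDet, indexedDet, ← Matrix.det_transpose]
  congr 1
  ext i j
  simp [add_comm]

theorem indexedDet_eq_zero (h : ℕ → ℂ) {r : ι → ℕ} (c : ι → ℕ) {i j : ι} (hij : i ≠ j)
    (hr : r i = r j) : indexedDet h r c = 0 :=
  Matrix.det_zero_of_row_eq hij (by ext k; simp [hr])

theorem indexedDet_eq_sum (h : ℕ → ℂ) (r c : ι → ℕ) :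
    indexedDet h r c = ∑ σ : Equiv.Perm ι, (Equiv.Perm.sign σ : ℤ) * ∏ i, h (r i + c (σ i)) := by
  rw [indexedDet_comm, indexedDet, Matrix.det_apply']
  simp [add_comm]

theorem hasDerivAt_indexedDet {h : ℕ → ℝ → ℂ} {x : ℝ}
    (hh : ∀ k, HasDerivAt (h k) (h (k + 1) x) x) (r c : ι → ℕ) :
    HasDerivAt (fun y => indexedDet (fun k => h k y) r c)
      (∑ i, indexedDet (fun k => h k x) (Function.update r i (r i + 1)) c) x := by
  simp only [indexedDet_eq_sum]
  rw [Finset.sum_comm]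
  refine HasDerivAt.fun_sum fun σ _ => ?_
  rw [← Finset.mul_sum]
  refine HasDerivAt.const_mul _ ?_
  refine (HasDerivAt.fun_finsetProd (u := Finset.univ)
    fun i _ => hh (r i + c (σ i))).congr_deriv ?_
  refine Finset.sum_congr rfl fun i _ => ?_
  rw [← Finset.mul_prod_erase _ _ (Finset.mem_univ i), smul_eq_mul, mul_comm]
  congr 1
  · simp [add_right_comm]
  · refine Finset.prod_congr rfl fun j hj => ?_
    rw [Function.update_of_ne (Finset.ne_of_mem_erase hj)]

end indexedDet

/-- The `n × n` Hankel determinant with entries `h (j + k)`. -/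
noncomputable def hankel (h : ℕ → ℂ) (n : ℕ) : ℂ := indexedDet h (Fin.val : Fin n → ℕ) Fin.val

/-- The row indices `0, …, n - 1, n + 1`. -/
def gapIndex (n : ℕ) : Fin (n + 1) → ℕ := Function.update Fin.val (Fin.last n) (n + 1)

/-- Raising any row index but the last makes two consecutive rows equal. -/
theorem sum_indexedDet_update_val (h : ℕ → ℂ) (n : ℕ) (c : Fin (n + 1) → ℕ) :
    ∑ i : Fin (n + 1), indexedDet h (Function.update Fin.val i ((i : ℕ) + 1)) c =
      indexedDet h (gapIndex n) c := by
  rw [Finset.sum_eq_single (Fin.last n)]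
  · simp [gapIndex]
  · intro i _ hi
    obtain ⟨j, rfl⟩ := Fin.exists_castSucc_eq.2 hi
    refine indexedDet_eq_zero h c (i := j.castSucc) (j := j.succ) (Fin.castSucc_lt_succ).ne ?_
    rw [Function.update_self, Function.update_of_ne (Fin.castSucc_lt_succ).ne']
    simp
  · simp

theorem hasDerivAt_hankel {h : ℕ → ℝ → ℂ} {x : ℝ} (hh : ∀ k, HasDerivAt (h k) (h (k + 1) x) x)
    (n : ℕ) : HasDerivAt (fun y => hankel (fun k => h k y) (n + 1))
      (indexedDet (fun k => h k x) (gapIndex n) Fin.val) x :=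
  (hasDerivAt_indexedDet hh Fin.val Fin.val).congr_deriv (sum_indexedDet_update_val _ n _)

/-- By symmetry the second differentiation can act on the columns, so the second derivative is again
a single determinant. -/
theorem hasDerivAt_hankel_deriv {h : ℕ → ℝ → ℂ} {x : ℝ}
    (hh : ∀ k, HasDerivAt (h k) (h (k + 1) x) x) (n : ℕ) :
    HasDerivAt (fun y => indexedDet (fun k => h k y) (gapIndex n) Fin.val)
      (indexedDet (fun k => h k x) (gapIndex n) (gapIndex n)) x := by
  simp_rw [indexedDet_comm _ (gapIndex n) Fin.val]
  exact (hasDerivAt_indexedDet hh Fin.val (gapIndex n)).congr_deriv (sum_indexedDet_update_val _ n _)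

/-- The Schur complement of the leading block `A`, which is common to all bordered determinants in
Jacobi's identity. -/
theorem indexedDet_snoc (h : ℕ → ℂ) {n : ℕ} {A : Matrix (Fin n) (Fin n) ℂ}
    (hA : A = Matrix.of fun i j : Fin n => h ((i : ℕ) + j)) [Invertible A] {r c : Fin (n + 1) → ℕ}
    (hr : ∀ i : Fin n, r i.castSucc = i) (hc : ∀ i : Fin n, c i.castSucc = i) :
    indexedDet h r c = A.det * (h (r (Fin.last n) + c (Fin.last n)) -
      ((Matrix.of fun (_ : Unit) (j : Fin n) => h (r (Fin.last n) + j)) * ⅟A *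
        Matrix.of fun (i : Fin n) (_ : Unit) => h (i + c (Fin.last n))) () ()) := by
  have h1 : indexedDet h r c = (Matrix.fromBlocks A
      (Matrix.of fun (i : Fin n) (_ : Unit) => h (i + c (Fin.last n)))
      (Matrix.of fun (_ : Unit) (j : Fin n) => h (r (Fin.last n) + j))
      (Matrix.of fun (_ _ : Unit) => h (r (Fin.last n) + c (Fin.last n)))).det := by
    rw [indexedDet, ← Matrix.det_submatrix_equiv_self
      ((Equiv.sumCongr (Equiv.refl (Fin n)) (Equiv.ofUnique Unit (Fin 1))).trans finSumFinEquiv)]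
    congr 1
    have hl : Fin.natAdd n (0 : Fin 1) = Fin.last n := by ext; simp
    have hcs (i : Fin n) : Fin.castAdd 1 i = i.castSucc := rfl
    ext (i | i) (j | j) <;> simp [hA, hl, hcs, hr, hc]
  rw [h1, Matrix.det_fromBlocks₁₁, Matrix.det_unique (n := Unit)]
  rfl

/-- Jacobi's identity for the last two rows and columns of a Hankel determinant. -/
theorem hankel_jacobi (h : ℕ → ℂ) (n : ℕ) (h0 : hankel h n ≠ 0) :
    hankel h (n + 2) * hankel h n = hankel h (n + 1) * indexedDet h (gapIndex n) (gapIndex n) -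
      indexedDet h (gapIndex n) Fin.val ^ 2 := by
  set A : Matrix (Fin n) (Fin n) ℂ := Matrix.of fun i j => h ((i : ℕ) + j) with hA
  have hAdet : A.det = hankel h n := rfl
  have : Invertible A := Matrix.invertibleOfIsUnitDet A (by rw [hAdet]; exact h0.isUnit)
  have hv (i : Fin n) : Fin.val i.castSucc = i := rfl
  have hg (i : Fin n) : gapIndex n i.castSucc = i := by
    rw [gapIndex, Function.update_of_ne (Fin.castSucc_lt_last i).ne]
    rfl
  have hgl : gapIndex n (Fin.last n) = n + 1 := by simp [gapIndex]
  -- Let `S` be the 2×2 Schur complement of `A`. The bordered determinants are `det A` times entries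
  -- of `S`, and the largest one is `det A * det S`; the identity is the expansion of `det S`. One
  -- factor of the square is transposed below to produce `S₀₁S₁₀`.
  have h1 : hankel h (n + 2) = (Matrix.fromBlocks A
      (Matrix.of fun (i : Fin n) (j : Fin 2) => h (i + (n + j)))
      (Matrix.of fun (i : Fin 2) (j : Fin n) => h (n + i + j))
      (Matrix.of fun (i j : Fin 2) => h (n + i + (n + j)))).det := by
    rw [hankel, indexedDet, ← Matrix.det_submatrix_equiv_self finSumFinEquiv]
    congr 1
    ext (i | i) (j | j) <;> simp [hA]
  have h2 : hankel h (n + 1) = _ := indexedDet_snoc h hA hv hv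
  rw [sq]
  nth_rewrite 3 [indexedDet_comm]
  rw [h1, h2, indexedDet_snoc h hA hg hg, indexedDet_snoc h hA hg hv, indexedDet_snoc h hA hv hg,
    Matrix.det_fromBlocks₁₁, Matrix.det_fin_two, hAdet]
  simp only [hgl, Fin.val_last, Matrix.sub_apply, Matrix.of_apply, Fin.val_zero, Fin.val_one,
    add_zero, Matrix.mul_apply]
  ring

/-- The logarithmic derivatives of Hankel determinants satisfy the Toda recursion. -/
theorem logDeriv_hankel_add_two {h : ℕ → ℝ → ℂ} (hh : ∀ k x, HasDerivAt (h k) (h (k + 1) x) x)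
    {n : ℕ} (h₀ : ∀ᶠ x in atTop, hankel (fun k => h k x) n ≠ 0)
    (h₁ : ∀ᶠ x in atTop, hankel (fun k => h k x) (n + 1) ≠ 0)
    (h₂ : ∀ᶠ x in atTop, deriv (logDeriv fun y => hankel (fun k => h k y) (n + 1)) x ≠ 0) :
    (∀ᶠ x in atTop, hankel (fun k => h k x) (n + 2) ≠ 0) ∧
    (logDeriv fun y => hankel (fun k => h k y) (n + 2)) =ᶠ[atTop] fun x =>
      2 * logDeriv (fun y => hankel (fun k => h k y) (n + 1)) x -
      logDeriv (fun y => hankel (fun k => h k y) n) x +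
      deriv (deriv (logDeriv fun y => hankel (fun k => h k y) (n + 1))) x /
        deriv (logDeriv fun y => hankel (fun k => h k y) (n + 1)) x := by
  set T : ℕ → ℝ → ℂ := fun m y => hankel (fun k => h k y) m with hT
  have hTd (m : ℕ) (x : ℝ) : DifferentiableAt ℝ (T m) x := by
    cases m with
    | zero => simp [hT, hankel, indexedDet]
    | succ m => exact (hasDerivAt_hankel (fun k => hh k x) m).differentiableAt
  have hT1 : deriv (T (n + 1)) =
      fun x => indexedDet (fun k => h k x) (gapIndex n) Fin.val :=
    funext fun x => (hasDerivAt_hankel (fun k => hh k x) n).deriv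
  -- Jacobi's identity rewrites the numerator `τ τ'' - τ'²`. Taking the logarithmic derivative of
  -- this formula gives the recursion, and `L₁' ≠ 0` forces `τ` of index `n + 2` not to vanish.
  have hL1 : ∀ᶠ x in atTop,
      deriv (logDeriv (T (n + 1))) x = T (n + 2) x * T n x / T (n + 1) x ^ 2 := by
    filter_upwards [h₀, h₁] with x hx0 hx1
    have h3 := ((hasDerivAt_hankel_deriv (fun k => hh k x) n).fun_div
      (hasDerivAt_hankel (fun k => hh k x) n) hx1).deriv
    have h4 : logDeriv (T (n + 1)) = fun y =>
        indexedDet (fun k => h k y) (gapIndex n) Fin.val / hankel (fun k => h k y) (n + 1) := by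
      funext y
      rw [logDeriv_apply, hT1]
    rw [h4, h3]
    change _ = hankel (fun k => h k x) (n + 2) * hankel (fun k => h k x) n / _
    rw [hankel_jacobi (fun k => h k x) n hx0]
    ring
  have hT2 : ∀ᶠ x in atTop, T (n + 2) x ≠ 0 := by
    filter_upwards [hL1, h₂] with x hx1 hx2 h3
    rw [h3] at hx1
    exact hx2 (by rw [hx1]; simp)
  refine ⟨hT2, ?_⟩
  filter_upwards [hL1, deriv_eventuallyEq_atTop hL1, h₀, h₁, hT2] with x h3 h4 h5 h6 h7
  have h8 := (((hTd (n + 2) x).hasDerivAt.mul (hTd n x).hasDerivAt).fun_div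
    ((hTd (n + 1) x).hasDerivAt.fun_pow 2) (pow_ne_zero 2 h6)).deriv
  simp only [Pi.mul_apply] at h8
  rw [h3, h4, h8]
  change deriv (T (n + 2)) x / T (n + 2) x = 2 * (deriv (T (n + 1)) x / T (n + 1) x) -
    deriv (T n) x / T n x + _
  change T n x ≠ 0 at h5
  change T (n + 1) x ≠ 0 at h6
  field_simp
  push_cast
  ring

/-- Two-step induction carrying non-vanishing along with the expansion: for positive index the
derivative of the logarithmic derivative has the nonzero leading coefficient `s n / 2`. -/
theorem symbol_logDeriv_hankel {s : ℝ} (hs : s ^ 2 = 1 / 2) {h : ℕ → ℝ → ℂ}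
    (hh : ∀ k x, HasDerivAt (h k) (h (k + 1) x) x) (h0 : ∀ᶠ x in atTop, h 0 x ≠ 0)
    (h1 : Symbol (-4) (fun x => h 1 x / h 0 x - expansion s 1 x)) (n : ℕ) :
    (∀ᶠ x in atTop, hankel (fun k => h k x) n ≠ 0) ∧
    Symbol (-4) (fun x => logDeriv (fun y => hankel (fun k => h k y) n) x - expansion s n x) := by
  have hsC : (s : ℂ) ^ 2 = 1 / 2 := by rw [← Complex.ofReal_pow, hs]; norm_num
  induction n using Nat.twoStepInduction with
  | zero =>
    refine ⟨by simp [hankel, indexedDet], ?_⟩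
    have := (Symbol.rpow (-4)).const_mul 0
    refine this.congr (Eventually.of_forall fun x => ?_)
    simp [hankel, indexedDet, expansion, logDeriv_apply]
  | one =>
    have h2 (x : ℝ) : hankel (fun k => h k x) 1 = h 0 x := by simp [hankel, indexedDet]
    refine ⟨by simpa only [h2] using h0, ?_⟩
    simp only [h2]
    refine h1.congr (Eventually.of_forall fun x => ?_)
    change _ = logDeriv (h 0) x - _
    rw [logDeriv_apply, (hh 0 x).deriv, Nat.cast_one]
  | more n ih0 ih1 =>
    have hc : ((n + 1 : ℕ) : ℂ) - 1 = n := by push_cast; ring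
    have hc' : ((n + 1 : ℕ) : ℂ) + 1 = (n + 2 : ℕ) := by push_cast; ring
    have h3 := symbol_toda hsC (n := ((n + 1 : ℕ) : ℂ)) (by exact_mod_cast n.succ_ne_zero)
      (by rw [hc]; exact ih0.2) ih1.2
    have h4 := logDeriv_hankel_add_two hh ih0.1 ih1.1 h3.1
    refine ⟨h4.1, h3.2.congr ?_⟩
    filter_upwards [h4.2] with x hx
    rw [hx, hc']

/-! ### The Airy functions -/

/-- The moments `∫ s ^ k exp (- s ^ 3 / 3 - z ω s) ds` over the positive half-line. -/
noncomputable def moment (ω : ℂ) (k : ℕ) (z : ℂ) : ℂ :=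
  ∫ s in Set.Ioi (0 : ℝ), (s : ℂ) ^ k * Complex.exp (-(s : ℂ) ^ 3 / 3 - z * ω * s)

theorem integrableOn_pow_mul_exp (k : ℕ) (c : ℝ) :
    IntegrableOn (fun s : ℝ => s ^ k * Real.exp (-s ^ 3 / 3 + c * s)) (Set.Ioi 0) := by
  have h1 : IntegrableOn (fun s : ℝ => s ^ (k : ℝ) * Real.exp (-1 * s ^ (1 : ℝ))) (Set.Ioi 0) :=
    integrableOn_rpow_mul_exp_neg_mul_rpow (by linarith [k.cast_nonneg (α := ℝ)]) one_pos one_pos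
  -- With `d = |c| + 1`: if `s² ≥ 3d` the cubic term absorbs `d s`; otherwise `s ≤ (s² + 1)/2`
  -- bounds `d s` by `d (3d + 1)`.
  have hb : ∀ s : ℝ, 0 < s → -s ^ 3 / 3 + c * s ≤ (|c| + 1) * (3 * (|c| + 1) + 1) + -1 * s := by
    intro s hs
    have hc := le_abs_self c
    set d := |c| + 1 with hd
    have hd1 : 1 ≤ d := by rw [hd]; linarith [abs_nonneg c]
    have h2 : c * s ≤ d * s - s := by nlinarith
    rcases le_total (3 * d) (s ^ 2) with h3 | h3
    · nlinarith [mul_le_mul_of_nonneg_right h3 hs.le]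
    · nlinarith [sq_nonneg (s - 1), pow_pos hs 3]
  refine Integrable.mono' (g := fun s : ℝ => Real.exp ((|c| + 1) * (3 * (|c| + 1) + 1)) *
    (s ^ (k : ℝ) * Real.exp (-1 * s ^ (1 : ℝ)))) (h1.const_mul _)
    (by fun_prop) ?_
  filter_upwards [ae_restrict_mem measurableSet_Ioi] with s hs
  have hs : 0 < s := hs
  rw [Real.norm_of_nonneg (by positivity), Real.rpow_natCast, Real.rpow_one, mul_left_comm,
    ← Real.exp_add]
  exact mul_le_mul_of_nonneg_left (Real.exp_le_exp.2 (hb s hs)) (by positivity)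

theorem norm_moment_integrand_le (ω : ℂ) (k : ℕ) (z : ℂ) {s c : ℝ} (hs : 0 < s)
    (hc : -(z * ω).re ≤ c) :
    ‖(s : ℂ) ^ k * Complex.exp (-(s : ℂ) ^ 3 / 3 - z * ω * s)‖ ≤
      s ^ k * Real.exp (-s ^ 3 / 3 + c * s) := by
  rw [norm_mul, norm_pow, Complex.norm_of_nonneg hs.le, Complex.norm_exp]
  have h1 : (-(s : ℂ) ^ 3 / 3 - z * ω * s).re = -s ^ 3 / 3 + -(z * ω).re * s := by
    have : -(s : ℂ) ^ 3 / 3 = ((-s ^ 3 / 3 : ℝ) : ℂ) := by push_cast; ring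
    rw [Complex.sub_re, this, Complex.ofReal_re, Complex.re_mul_ofReal]
    ring
  rw [h1]
  gcongr

theorem integrableOn_moment (ω : ℂ) (k : ℕ) (z : ℂ) :
    IntegrableOn (fun s : ℝ => (s : ℂ) ^ k * Complex.exp (-(s : ℂ) ^ 3 / 3 - z * ω * s))
      (Set.Ioi 0) := by
  refine Integrable.mono' (integrableOn_pow_mul_exp k (-(z * ω).re)) (by fun_prop) ?_
  filter_upwards [ae_restrict_mem measurableSet_Ioi] with s hs
  exact norm_moment_integrand_le ω k z hs le_rfl

theorem norm_moment_le (ω : ℂ) (k : ℕ) (z : ℂ) {c : ℝ} (hc : -(z * ω).re ≤ c) :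
    ‖moment ω k z‖ ≤ ∫ s in Set.Ioi (0 : ℝ), s ^ k * Real.exp (-s ^ 3 / 3 + c * s) := by
  refine norm_integral_le_of_norm_le (integrableOn_pow_mul_exp k c) ?_
  filter_upwards [ae_restrict_mem measurableSet_Ioi] with s hs
  exact norm_moment_integrand_le ω k z hs hc

theorem hasDerivAt_moment (ω : ℂ) (k : ℕ) (z : ℂ) :
    HasDerivAt (moment ω k) (-ω * moment ω (k + 1) z) z := by
  set F' : ℂ → ℝ → ℂ := fun z s =>
    -ω * ((s : ℂ) ^ (k + 1) * Complex.exp (-(s : ℂ) ^ 3 / 3 - z * ω * s)) with hF'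
  have key := hasDerivAt_integral_of_dominated_loc_of_deriv_le (𝕜 := ℂ)
    (μ := volume.restrict (Set.Ioi (0 : ℝ)))
    (F := fun z s => (s : ℂ) ^ k * Complex.exp (-(s : ℂ) ^ 3 / 3 - z * ω * s))
    (F' := F') (x₀ := z) (s := Metric.ball z 1)
    (bound := fun s => ‖ω‖ * (s ^ (k + 1) * Real.exp (-s ^ 3 / 3 + (‖z‖ + 1) * ‖ω‖ * s)))
    (Metric.ball_mem_nhds z one_pos) (Eventually.of_forall fun z => (integrableOn_moment ω k z).1)
    (integrableOn_moment ω k z) ((integrableOn_moment ω (k + 1) z).const_mul (-ω)).1 ?_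
    ((integrableOn_pow_mul_exp _ _).const_mul _) ?_
  · have h := key.2
    simp only [hF', integral_const_mul] at h
    exact h
  · filter_upwards [ae_restrict_mem measurableSet_Ioi] with s hs w hw
    have hw : ‖w‖ ≤ ‖z‖ + 1 := by
      have h1 := norm_le_norm_add_norm_sub' w z
      have h2 := (mem_ball_iff_norm.1 hw).le
      linarith
    rw [norm_mul, norm_neg]
    gcongr
    refine norm_moment_integrand_le ω (k + 1) w hs ?_
    calc -(w * ω).re ≤ ‖w * ω‖ := (neg_le_abs _).trans (Complex.abs_re_le_norm _)
      _ ≤ _ := by rw [norm_mul]; gcongr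
  · refine Eventually.of_forall fun s w _ => ?_
    have h1 : HasDerivAt (fun w : ℂ => -(s : ℂ) ^ 3 / 3 - w * ω * s) (-(ω * s)) w := by
      refine ((((hasDerivAt_id w).mul_const ω).mul_const (s : ℂ)).const_sub _).congr_deriv ?_
      simp
    refine (h1.cexp.const_mul _).congr_deriv ?_
    simp only [hF']
    ring

/-- The left side integrates a total derivative along the ray; `-1` is the boundary term at the
origin. -/
theorem moment_two_sub (ω : ℂ) (hω : ω ^ 3 = -1) (z : ℂ) :
    ω ^ 3 * moment ω 2 z - z * ω * moment ω 0 z = -1 := by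
  have hi := ((integrableOn_moment ω 2 z).const_mul (ω ^ 3)).sub
    ((integrableOn_moment ω 0 z).const_mul (z * ω))
  have hd (s : ℝ) : HasDerivAt (fun s : ℝ => Complex.exp (-(s : ℂ) ^ 3 / 3 - z * ω * s))
      (ω ^ 3 * ((s : ℂ) ^ 2 * Complex.exp (-(s : ℂ) ^ 3 / 3 - z * ω * s)) -
        z * ω * ((s : ℂ) ^ 0 * Complex.exp (-(s : ℂ) ^ 3 / 3 - z * ω * s))) s := by
    have h1 : HasDerivAt (fun w : ℂ => -w ^ 3 / 3 - z * ω * w) (-(s : ℂ) ^ 2 - z * ω) (s : ℂ) := by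
      refine ((((hasDerivAt_id (s : ℂ)).fun_pow 3).fun_neg.div_const 3).sub
        ((hasDerivAt_id (s : ℂ)).const_mul (z * ω))).congr_deriv ?_
      simp
      ring
    refine h1.cexp.comp_ofReal.congr_deriv ?_
    rw [hω]
    ring
  have hlim : Tendsto (fun s : ℝ => Complex.exp (-(s : ℂ) ^ 3 / 3 - z * ω * s)) atTop (𝓝 0) :=
    tendsto_zero_of_hasDerivAt_of_integrableOn_Ioi (a := 0) (fun s _ => hd s) hi
      (by simpa using integrableOn_moment ω 0 z)
  have h := integral_Ioi_of_hasDerivAt_of_tendsto (hd 0).continuousAt.continuousWithinAt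
    (fun s _ => hd s) hi hlim
  have h2 := integral_sub ((integrableOn_moment ω 2 z).const_mul (ω ^ 3))
    ((integrableOn_moment ω 0 z).const_mul (z * ω))
  simp only [integral_const_mul] at h2
  rw [moment, moment, ← h2]
  refine h.trans ?_
  simp

theorem rayIntegral_eq (ω : ℂ) (hω : ω ^ 3 = -1) (z : ℂ) :
    AiryPainleve.rayIntegral ω z = ω * moment ω 0 z := by
  rw [AiryPainleve.rayIntegral, moment, ← integral_const_mul]
  congr 1
  funext s
  rw [mul_pow, hω, pow_zero, one_mul, mul_comm]
  congr 2
  ring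

open AiryPainleve

theorem ωPlus_eq : ωPlus = ((1 / 2 : ℝ) : ℂ) + ((√3 / 2 : ℝ) : ℂ) * Complex.I := by
  rw [ωPlus, show (Real.pi * Complex.I / 3 : ℂ) = ((Real.pi / 3 : ℝ) : ℂ) * Complex.I by
    push_cast; ring, Complex.exp_mul_I, ← Complex.ofReal_cos, ← Complex.ofReal_sin,
    Real.cos_pi_div_three, Real.sin_pi_div_three]

theorem ωMinus_eq : ωMinus = ((1 / 2 : ℝ) : ℂ) - ((√3 / 2 : ℝ) : ℂ) * Complex.I := by
  rw [ωMinus, show (-(Real.pi * Complex.I / 3) : ℂ) = -((Real.pi / 3 : ℝ) : ℂ) * Complex.I by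
    push_cast; ring, Complex.exp_mul_I, Complex.cos_neg, Complex.sin_neg, ← Complex.ofReal_cos,
    ← Complex.ofReal_sin, Real.cos_pi_div_three, Real.sin_pi_div_three]
  ring

theorem ωPlus_cube : ωPlus ^ 3 = -1 := by
  rw [ωPlus, ← Complex.exp_nat_mul, ← Complex.exp_pi_mul_I]
  congr 1
  push_cast
  ring

theorem ωMinus_cube : ωMinus ^ 3 = -1 := by
  rw [ωMinus, ← Complex.exp_nat_mul]
  calc _ = Complex.exp (-(Real.pi * Complex.I)) := by congr 1; push_cast; ring
    _ = _ := by rw [Complex.exp_neg, Complex.exp_pi_mul_I]; norm_num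

theorem ωPlus_re : ωPlus.re = 1 / 2 := by rw [ωPlus_eq]; simp

theorem ωMinus_re : ωMinus.re = 1 / 2 := by rw [ωMinus_eq]; simp

/-- The derivative of `rayIntegral ω`. -/
noncomputable def rayIntegralDeriv (ω z : ℂ) : ℂ := -ω ^ 2 * moment ω 1 z

theorem hasDerivAt_rayIntegral {ω : ℂ} (hω : ω ^ 3 = -1) (z : ℂ) :
    HasDerivAt (rayIntegral ω) (rayIntegralDeriv ω z) z := by
  rw [show rayIntegral ω = fun z => ω * moment ω 0 z from funext (rayIntegral_eq ω hω)]
  refine ((hasDerivAt_moment ω 0 z).const_mul ω).congr_deriv ?_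
  rw [rayIntegralDeriv]
  ring

/-- Each ray integral solves `y'' = z y - 1`; the constant cancels in the differences of rays
defining `Ai` and `Bi`. -/
theorem hasDerivAt_rayIntegralDeriv {ω : ℂ} (hω : ω ^ 3 = -1) (z : ℂ) :
    HasDerivAt (rayIntegralDeriv ω) (z * rayIntegral ω z - 1) z := by
  refine ((hasDerivAt_moment ω 1 z).const_mul (-ω ^ 2)).congr_deriv ?_
  rw [rayIntegral_eq ω hω]
  linear_combination moment_two_sub ω hω z

/-- The derivative of `Ai`. -/
noncomputable def AiDeriv (z : ℂ) : ℂ :=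
  1 / (2 * Real.pi * Complex.I) * (rayIntegralDeriv ωPlus z - rayIntegralDeriv ωMinus z)

/-- The derivative of `Bi`. -/
noncomputable def BiDeriv (z : ℂ) : ℂ :=
  1 / (2 * Real.pi) * (rayIntegralDeriv ωPlus z - rayIntegralDeriv (-1) z) +
    1 / (2 * Real.pi) * (rayIntegralDeriv ωMinus z - rayIntegralDeriv (-1) z)

theorem hasDerivAt_Ai (z : ℂ) : HasDerivAt Ai (AiDeriv z) z :=
  ((hasDerivAt_rayIntegral ωPlus_cube z).sub (hasDerivAt_rayIntegral ωMinus_cube z)).const_mul _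

theorem hasDerivAt_AiDeriv (z : ℂ) : HasDerivAt AiDeriv (z * Ai z) z := by
  refine (((hasDerivAt_rayIntegralDeriv ωPlus_cube z).sub
    (hasDerivAt_rayIntegralDeriv ωMinus_cube z)).const_mul _).congr_deriv ?_
  rw [Ai]
  ring

theorem hasDerivAt_Bi (z : ℂ) : HasDerivAt Bi (BiDeriv z) z := by
  have h := hasDerivAt_rayIntegral (ω := -1) (by norm_num) z
  exact (((hasDerivAt_rayIntegral ωPlus_cube z).sub h).const_mul _).add
    (((hasDerivAt_rayIntegral ωMinus_cube z).sub h).const_mul _)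

theorem hasDerivAt_BiDeriv (z : ℂ) : HasDerivAt BiDeriv (z * Bi z) z := by
  have h := hasDerivAt_rayIntegralDeriv (ω := -1) (by norm_num) z
  refine ((((hasDerivAt_rayIntegralDeriv ωPlus_cube z).sub h).const_mul _).add
    (((hasDerivAt_rayIntegralDeriv ωMinus_cube z).sub h).const_mul _)).congr_deriv ?_
  rw [Bi]
  ring

/-- On the rays `ωPlus` and `ωMinus` the factor `exp(-tωs)` has modulus at most `1` for `t ≥ 0`, so
only the ray `-1` can produce growth. -/
theorem exists_norm_moment_le {ω : ℂ} (hω : ω.re = 1 / 2) (k : ℕ) :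
    ∃ C, ∀ t : ℝ, 0 ≤ t → ‖moment ω k t‖ ≤ C :=
  ⟨_, fun t ht => norm_moment_le ω k t (c := 0) (by rw [Complex.re_ofReal_mul, hω]; linarith)⟩

theorem exists_norm_rayIntegral_le {ω : ℂ} (h3 : ω ^ 3 = -1) (hω : ω.re = 1 / 2) :
    ∃ C, ∀ t : ℝ, 0 ≤ t → ‖rayIntegral ω t‖ ≤ C ∧ ‖rayIntegralDeriv ω t‖ ≤ C := by
  obtain ⟨C₀, h0⟩ := exists_norm_moment_le hω 0
  obtain ⟨C₁, h1⟩ := exists_norm_moment_le hω 1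
  refine ⟨max (‖ω‖ * C₀) (‖-ω ^ 2‖ * C₁), fun t ht => ⟨?_, ?_⟩⟩
  · rw [rayIntegral_eq ω h3, norm_mul]
    exact le_max_of_le_left (by gcongr; exact h0 t ht)
  · rw [rayIntegralDeriv, norm_mul]
    exact le_max_of_le_right (by gcongr; exact h1 t ht)

theorem exists_norm_Ai_le : ∃ C, ∀ t : ℝ, 0 ≤ t → ‖Ai t‖ ≤ C ∧ ‖AiDeriv t‖ ≤ C := by
  obtain ⟨C, hC⟩ := exists_norm_rayIntegral_le ωPlus_cube ωPlus_re
  obtain ⟨D, hD⟩ := exists_norm_rayIntegral_le ωMinus_cube ωMinus_re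
  refine ⟨‖(1 / (2 * Real.pi * Complex.I) : ℂ)‖ * (C + D), fun t ht => ⟨?_, ?_⟩⟩
  · rw [Ai, norm_mul]
    gcongr
    exact (norm_sub_le _ _).trans (add_le_add (hC t ht).1 (hD t ht).1)
  · rw [AiDeriv, norm_mul]
    gcongr
    exact (norm_sub_le _ _).trans (add_le_add (hC t ht).2 (hD t ht).2)

theorem integral_pow_mul_exp_pos (k : ℕ) :
    0 < ∫ s in Set.Ioi (0 : ℝ), s ^ k * Real.exp (-s ^ 3 / 3) := by
  have hpos : ∀ s : ℝ, 0 < s → 0 < s ^ k * Real.exp (-s ^ 3 / 3) := fun s hs => by positivity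
  rw [setIntegral_pos_iff_support_of_nonneg_ae]
  · have : Function.support (fun s : ℝ => s ^ k * Real.exp (-s ^ 3 / 3)) ∩ Set.Ioi 0 = Set.Ioi 0 :=
      Set.inter_eq_right.2 fun s hs => (hpos s hs).ne'
    rw [this]
    simp
  · filter_upwards [ae_restrict_mem measurableSet_Ioi] with s hs using (hpos s hs).le
  · simpa using integrableOn_pow_mul_exp k 0

theorem moment_neg_one_eq (t : ℝ) :
    moment (-1) 0 t = ((∫ s in Set.Ioi (0 : ℝ), s ^ 0 * Real.exp (-s ^ 3 / 3 + t * s) : ℝ) : ℂ) := by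
  rw [moment, ← integral_complex_ofReal]
  congr 1
  funext s
  simp

/-- The crude bound `exp(ts) ≥ ts` is enough, because only unboundedness of `Bi` is used. -/
theorem le_norm_moment_neg_one (t : ℝ) :
    t * ∫ s in Set.Ioi (0 : ℝ), s ^ 1 * Real.exp (-s ^ 3 / 3) ≤ ‖moment (-1) 0 t‖ := by
  rw [moment_neg_one_eq, Complex.norm_real, ← integral_const_mul]
  refine le_trans ?_ (le_abs_self _)
  refine setIntegral_mono_on ?_ (integrableOn_pow_mul_exp 0 t) measurableSet_Ioi fun s hs => ?_
  · simpa [IntegrableOn] using (integrableOn_pow_mul_exp 1 0).const_mul t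
  · rw [pow_one, pow_zero, one_mul, Real.exp_add, ← mul_assoc, mul_comm]
    gcongr
    linarith [Real.add_one_le_exp (t * s)]

theorem Bi_unbounded (C : ℝ) : ∀ᶠ t : ℝ in atTop, C ≤ ‖Bi t‖ := by
  obtain ⟨C₁, h1⟩ := exists_norm_rayIntegral_le ωPlus_cube ωPlus_re
  obtain ⟨C₂, h2⟩ := exists_norm_rayIntegral_le ωMinus_cube ωMinus_re
  have hpos := integral_pow_mul_exp_pos 1
  set c := ∫ s in Set.Ioi (0 : ℝ), s ^ 1 * Real.exp (-s ^ 3 / 3)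
  have htend := tendsto_id.atTop_mul_const hpos (l := atTop (α := ℝ))
  filter_upwards [htend.eventually_ge_atTop (Real.pi * C + (C₁ + C₂) / 2), eventually_ge_atTop 0]
    with t ht ht0
  have hB : 2 * Real.pi * Bi t =
      2 * moment (-1) 0 t - -(rayIntegral ωPlus t + rayIntegral ωMinus t) := by
    have hpi : (Real.pi : ℂ) ≠ 0 := Complex.ofReal_ne_zero.2 Real.pi_ne_zero
    rw [Bi, rayIntegral_eq (-1) (by norm_num)]
    field_simp
    ring
  have h3 := norm_sub_norm_le (2 * moment (-1) 0 t)
    (-(rayIntegral ωPlus t + rayIntegral ωMinus t))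
  have h4 := norm_add_le (rayIntegral ωPlus t) (rayIntegral ωMinus t)
  have h5 := le_norm_moment_neg_one t
  rw [← hB, norm_neg, norm_mul, norm_mul, norm_mul, Complex.norm_two,
    Complex.norm_of_nonneg Real.pi_pos.le] at h3
  have h6 : Real.pi * C ≤ Real.pi * ‖Bi t‖ := by
    simp only [id] at ht
    linarith [(h1 t ht0).1, (h2 t ht0).1]
  exact le_of_mul_le_mul_left h6 Real.pi_pos

/-- At `0` the moments of both rays are the same positive number, and `ωPlus - ωMinus = i√3`. -/
theorem Ai_zero_ne_zero : Ai 0 ≠ 0 := by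
  have hm (ω : ℂ) : moment ω 0 0 =
      ((∫ s in Set.Ioi (0 : ℝ), s ^ 0 * Real.exp (-s ^ 3 / 3) : ℝ) : ℂ) := by
    rw [moment, ← integral_complex_ofReal]
    congr 1
    funext s
    simp
  rw [Ai, rayIntegral_eq _ ωPlus_cube, rayIntegral_eq _ ωMinus_cube, hm, hm, ← sub_mul, ωPlus_eq,
    ωMinus_eq]
  have h3 : ((√3 / 2 : ℝ) : ℂ) ≠ 0 := Complex.ofReal_ne_zero.2 (by positivity)
  have h4 := Complex.ofReal_ne_zero.2 (integral_pow_mul_exp_pos 0).ne'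
  have hpi : (Real.pi : ℂ) ≠ 0 := Complex.ofReal_ne_zero.2 Real.pi_ne_zero
  refine mul_ne_zero (by simp [Complex.I_ne_zero]) (mul_ne_zero ?_ h4)
  rw [show ∀ a b : ℂ, a + b * Complex.I - (a - b * Complex.I) = 2 * b * Complex.I by
    intros; ring]
  exact mul_ne_zero (mul_ne_zero two_ne_zero h3) Complex.I_ne_zero

/-! ### Sign of the logarithmic derivative -/

section sign

variable {ψ ψ' : ℝ → ℂ}

theorem re_div_eq_inner (a b : ℂ) : (a / b).re = inner ℝ b a / ‖b‖ ^ 2 := by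
  rw [Complex.inner, Complex.div_re, ← Complex.normSq_eq_norm_sq, Complex.mul_re, Complex.conj_re,
    Complex.conj_im]
  ring

/-- The derivative is `‖ψ'‖² + (x/2)‖ψ‖²`. This inner product carries the sign of `Re(ψ'/ψ)` and is
half the derivative of `‖ψ‖²`. -/
theorem monotoneOn_inner (h : ∀ x, HasDerivAt ψ (ψ' x) x)
    (h' : ∀ x, HasDerivAt ψ' (x / 2 * ψ x) x) :
    MonotoneOn (fun x => inner ℝ (ψ x) (ψ' x)) (Set.Ici 0) := by
  have hd (x : ℝ) := (h x).inner ℝ (h' x)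
  refine monotoneOn_of_deriv_nonneg (convex_Ici 0)
    (fun x _ => (hd x).continuousAt.continuousWithinAt)
    (fun x _ => (hd x).differentiableAt.differentiableWithinAt) fun x hx => ?_
  rw [interior_Ici] at hx
  have hx : 0 < x := hx
  rw [(hd x).deriv, show (x / 2 * ψ x : ℂ) = (x / 2 : ℝ) • ψ x by simp, inner_smul_right,
    real_inner_self_eq_norm_sq, real_inner_self_eq_norm_sq]
  positivity

theorem antitoneOn_norm_sq (h : ∀ x, HasDerivAt ψ (ψ' x) x) {x₀ : ℝ}
    (hle : ∀ x ≥ x₀, inner ℝ (ψ x) (ψ' x) ≤ 0) :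
    AntitoneOn (fun x => ‖ψ x‖ ^ 2) (Set.Ici x₀) := by
  have hd (x : ℝ) := (h x).norm_sq
  refine antitoneOn_of_deriv_nonpos (convex_Ici x₀)
    (fun x _ => (hd x).continuousAt.continuousWithinAt)
    (fun x _ => (hd x).differentiableAt.differentiableWithinAt) fun x hx => ?_
  rw [(hd x).deriv]
  linarith [hle x (interior_subset hx)]

/-- Were the inner product never positive, `‖ψ‖` would be nonincreasing; once positive, it stays so
by monotonicity. -/
theorem logDeriv_re_nonneg_of_unbounded (h : ∀ x, HasDerivAt ψ (ψ' x) x)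
    (h' : ∀ x, HasDerivAt ψ' (x / 2 * ψ x) x) (hub : ∀ C, ∃ x ≥ 0, C < ‖ψ x‖) :
    (∀ᶠ x in atTop, ψ x ≠ 0) ∧ ∀ᶠ x in atTop, 0 ≤ (ψ' x / ψ x).re := by
  obtain ⟨x₀, hx₀, hpos⟩ : ∃ x₀ ≥ 0, 0 < inner ℝ (ψ x₀) (ψ' x₀) := by
    by_contra! hcon
    obtain ⟨x, hx, hlt⟩ := hub ‖ψ 0‖
    have := antitoneOn_norm_sq h hcon (Set.mem_Ici.2 le_rfl) (Set.mem_Ici.2 hx) hx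
    exact absurd (pow_le_pow_left₀ (norm_nonneg _) hlt.le 2) (by
      have := pow_lt_pow_left₀ hlt (norm_nonneg _) two_ne_zero
      simp only at *
      linarith)
  have hge : ∀ᶠ x in atTop, 0 < inner ℝ (ψ x) (ψ' x) := by
    filter_upwards [eventually_ge_atTop x₀] with x hx
    exact hpos.trans_le (monotoneOn_inner h h' hx₀ (hx₀.trans hx) hx)
  refine ⟨?_, ?_⟩
  · filter_upwards [hge] with x hx h0
    simp [h0] at hx
  · filter_upwards [hge] with x hx
    rw [re_div_eq_inner]
    positivity

/-- A positive value `δ` of the inner product would persist and make `‖ψ‖²` grow with slope at least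
`2δ`. Hence `‖ψ‖` is nonincreasing, and one zero would force all later values to vanish. -/
theorem logDeriv_re_nonpos_of_bounded (h : ∀ x, HasDerivAt ψ (ψ' x) x)
    (h' : ∀ x, HasDerivAt ψ' (x / 2 * ψ x) x) {C : ℝ} (hb : ∀ x ≥ 0, ‖ψ x‖ ≤ C)
    (hne : ∃ᶠ x in atTop, ψ x ≠ 0) :
    (∀ᶠ x in atTop, ψ x ≠ 0) ∧ ∀ᶠ x in atTop, (ψ' x / ψ x).re ≤ 0 := by
  have hle : ∀ x ≥ 0, inner ℝ (ψ x) (ψ' x) ≤ 0 := by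
    by_contra! hcon
    obtain ⟨x₀, hx₀, hpos⟩ := hcon
    set δ : ℝ := inner ℝ (ψ x₀) (ψ' x₀) with hδ
    have hd (x : ℝ) := (h x).norm_sq.sub ((hasDerivAt_id x).const_mul (2 * δ))
    have hmono : MonotoneOn ((fun x => ‖ψ x‖ ^ 2) - fun x => 2 * δ * id x) (Set.Ici x₀) := by
      refine monotoneOn_of_deriv_nonneg (convex_Ici x₀)
        (fun x _ => (hd x).continuousAt.continuousWithinAt)
        (fun x _ => (hd x).differentiableAt.differentiableWithinAt) fun x hx => ?_
      have hx : x₀ ≤ x := interior_subset hx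
      rw [(hd x).deriv]
      have : δ ≤ inner ℝ (ψ x) (ψ' x) := monotoneOn_inner h h' hx₀ (hx₀.trans hx) hx
      linarith
    have htend : Tendsto (fun x : ℝ => 2 * δ * x) atTop atTop :=
      tendsto_id.const_mul_atTop (by positivity)
    obtain ⟨x, hx1, hx2⟩ := ((htend.eventually_gt_atTop (C ^ 2 + 2 * δ * x₀)).and
      (eventually_ge_atTop x₀)).exists
    have h1 := hmono (Set.mem_Ici.2 le_rfl) hx2 hx2
    have h2 := pow_le_pow_left₀ (norm_nonneg _) (hb x (hx₀.trans hx2)) 2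
    simp only [Pi.sub_apply, id] at h1
    linarith [sq_nonneg ‖ψ x₀‖]
  refine ⟨?_, ?_⟩
  · filter_upwards [eventually_ge_atTop 0] with x hx h0
    obtain ⟨y, hy, hxy⟩ := (hne.and_eventually (eventually_ge_atTop x)).exists
    have h1 := antitoneOn_norm_sq h hle hx (hx.trans hxy) hxy
    simp only [h0, norm_zero] at h1
    have : 0 < ‖ψ y‖ := norm_pos_iff.2 hy
    nlinarith
  · filter_upwards [eventually_ge_atTop 0] with x hx
    rw [re_div_eq_inner]
    exact div_nonpos_of_nonpos_of_nonneg (hle x hx) (by positivity)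

end sign

/-! ### The Airy solutions `φ` and their Hankel determinants -/

theorem scale_cube : (-((2 : ℝ) ^ (-(1 / 3) : ℝ) : ℝ) : ℂ) ^ 3 = -(1 / 2) := by
  have h : ((2 : ℝ) ^ (-(1 / 3) : ℝ)) ^ 3 = 1 / 2 := by
    rw [← Real.rpow_natCast, ← Real.rpow_mul (by norm_num)]
    norm_num
  rw [neg_pow, ← Complex.ofReal_pow, h]
  norm_num

/-- The derivative of `φ ϑ`. -/
noncomputable def φDeriv (ϑ z : ℂ) : ℂ :=
  (-((2 : ℝ) ^ (-(1 / 3) : ℝ) : ℝ)) *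
    (Complex.cos ϑ * AiDeriv (-((2 : ℝ) ^ (-(1 / 3) : ℝ) : ℝ) * z) +
      Complex.sin ϑ * BiDeriv (-((2 : ℝ) ^ (-(1 / 3) : ℝ) : ℝ) * z))

theorem hasDerivAt_φ (ϑ z : ℂ) : HasDerivAt (φ ϑ) (φDeriv ϑ z) z := by
  have hl := (hasDerivAt_id z).const_mul (-((2 : ℝ) ^ (-(1 / 3) : ℝ) : ℝ) : ℂ)
  refine ((((hasDerivAt_Ai _).comp z hl).const_mul (Complex.cos ϑ)).add
    (((hasDerivAt_Bi _).comp z hl).const_mul (Complex.sin ϑ))).congr_deriv ?_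
  rw [φDeriv]
  simp only [id]
  ring

theorem hasDerivAt_φDeriv (ϑ z : ℂ) : HasDerivAt (φDeriv ϑ) (-(z / 2) * φ ϑ z) z := by
  have hl := (hasDerivAt_id z).const_mul (-((2 : ℝ) ^ (-(1 / 3) : ℝ) : ℝ) : ℂ)
  refine (((((hasDerivAt_AiDeriv _).comp z hl).const_mul (Complex.cos ϑ)).add
    (((hasDerivAt_BiDeriv _).comp z hl).const_mul (Complex.sin ϑ))).const_mul _).congr_deriv ?_
  rw [φ]
  simp only [id]
  have h3 := scale_cube
  generalize (-((2 : ℝ) ^ (-(1 / 3) : ℝ) : ℝ) : ℂ) = κ at *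
  linear_combination (z * (Complex.cos ϑ * Ai (κ * z) + Complex.sin ϑ * Bi (κ * z))) * h3

theorem contDiff_φ (ϑ : ℂ) : ContDiff ℂ ⊤ (φ ϑ) :=
  Differentiable.contDiff fun z => (hasDerivAt_φ ϑ z).differentiableAt

/-- The `k`-th derivative of `x ↦ φ(-x; ϑ)` on the real line. -/
noncomputable def reflectedDeriv (ϑ : ℂ) (k : ℕ) (x : ℝ) : ℂ :=
  (-1) ^ k * iteratedDeriv k (φ ϑ) (-x : ℂ)

theorem hasDerivAt_iteratedDeriv_φ (ϑ : ℂ) (k : ℕ) (z : ℂ) :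
    HasDerivAt (iteratedDeriv k (φ ϑ)) (iteratedDeriv (k + 1) (φ ϑ) z) z := by
  rw [iteratedDeriv_succ]
  exact ((contDiff_φ ϑ).differentiable_iteratedDeriv k (by simp) z).hasDerivAt

theorem hasDerivAt_reflectedDeriv (ϑ : ℂ) (k : ℕ) (x : ℝ) :
    HasDerivAt (reflectedDeriv ϑ k) (reflectedDeriv ϑ (k + 1) x) x := by
  have h : HasDerivAt (fun z : ℂ => (-1) ^ k * iteratedDeriv k (φ ϑ) (-z))
      (reflectedDeriv ϑ (k + 1) x) (x : ℂ) := by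
    refine (((hasDerivAt_iteratedDeriv_φ ϑ k (-x : ℂ)).comp (x : ℂ)
      (hasDerivAt_neg (x : ℂ))).const_mul ((-1 : ℂ) ^ k)).congr_deriv ?_
    rw [reflectedDeriv]
    ring
  exact h.comp_ofReal

theorem reflectedDeriv_zero (ϑ : ℂ) (x : ℝ) : reflectedDeriv ϑ 0 x = φ ϑ (-x) := by
  simp [reflectedDeriv]

theorem reflectedDeriv_one (ϑ : ℂ) (x : ℝ) : reflectedDeriv ϑ 1 x = -φDeriv ϑ (-x) := by
  simp [reflectedDeriv, (hasDerivAt_φ ϑ _).deriv]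

theorem hasDerivAt_reflectedDeriv_one (ϑ : ℂ) (x : ℝ) :
    HasDerivAt (reflectedDeriv ϑ 1) (x / 2 * reflectedDeriv ϑ 0 x) x := by
  refine (hasDerivAt_reflectedDeriv ϑ 1 x).congr_deriv ?_
  have h : deriv (φ ϑ) = φDeriv ϑ := funext fun z => (hasDerivAt_φ ϑ z).deriv
  rw [reflectedDeriv_zero, reflectedDeriv, iteratedDeriv_succ, iteratedDeriv_one, h,
    (hasDerivAt_φDeriv ϑ _).deriv]
  ring

/-- Reflection multiplies the entry `(j, k)` by `(-1)^(j+k)`; the row signs and column signs cancel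
in the determinant. -/
theorem τ_neg_eq_hankel (n : ℕ) (ϑ : ℂ) (x : ℝ) :
    τ n ϑ (-x : ℂ) = hankel (fun k => reflectedDeriv ϑ k x) n := by
  have h1 : hankel (fun k => reflectedDeriv ϑ k x) n =
      (Matrix.of fun i j : Fin n => (-1 : ℂ) ^ (i : ℕ) * (Matrix.of fun i j : Fin n =>
        (-1 : ℂ) ^ (j : ℕ) * (Matrix.of fun j k : Fin n =>
          iteratedDeriv ((j : ℕ) + (k : ℕ)) (φ ϑ) (-x : ℂ)) i j) i j).det := by
    rw [hankel, indexedDet]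
    congr 1
    ext i j
    simp only [Matrix.of_apply, reflectedDeriv, pow_add]
    ring
  rw [h1, Matrix.det_mul_column, Matrix.det_mul_row, ← mul_assoc, ← Finset.prod_mul_distrib]
  simp [← mul_pow, τ]

theorem differentiable_τ (n : ℕ) (ϑ : ℂ) : Differentiable ℂ (τ n ϑ) := by
  have h (k : ℕ) : Differentiable ℂ (iteratedDeriv k (φ ϑ)) :=
    fun z => (hasDerivAt_iteratedDeriv_φ ϑ k z).differentiableAt
  have h1 : τ n ϑ = fun z => ∑ σ : Equiv.Perm (Fin n), ((Equiv.Perm.sign σ : ℤ) : ℂ) *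
      ∏ i, iteratedDeriv ((σ i : ℕ) + (i : ℕ)) (φ ϑ) z := by
    funext z
    rw [τ, Matrix.det_apply']
    rfl
  rw [h1]
  fun_prop

theorem logDeriv_hankel_eq (n : ℕ) (ϑ : ℂ) (x : ℝ) :
    logDeriv (fun y => hankel (fun k => reflectedDeriv ϑ k y) n) x = -σ n ϑ (-x : ℂ) := by
  have h1 : HasDerivAt (fun z : ℂ => τ n ϑ (-z)) (-deriv (τ n ϑ) (-x : ℂ)) (x : ℂ) := by
    refine ((differentiable_τ n ϑ (-x : ℂ)).hasDerivAt.comp (x : ℂ)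
      (hasDerivAt_neg (x : ℂ))).congr_deriv ?_
    ring
  have h2 : (fun y : ℝ => hankel (fun k => reflectedDeriv ϑ k y) n) = fun y : ℝ => τ n ϑ (-y : ℂ) :=
    funext fun y => (τ_neg_eq_hankel n ϑ y).symm
  rw [h2, logDeriv_apply, h1.comp_ofReal.deriv, σ, logDeriv_apply, neg_div]

theorem deriv_logDeriv_hankel_eq (n : ℕ) (ϑ : ℂ) {x : ℝ} (hx : τ n ϑ (-x : ℂ) ≠ 0) :
    deriv (logDeriv fun y => hankel (fun k => reflectedDeriv ϑ k y) n) x = -p n ϑ (-x : ℂ) / 2 := by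
  have h1 : DifferentiableAt ℂ (logDeriv (τ n ϑ)) (-x : ℂ) :=
    ((differentiable_τ n ϑ).contDiff (n := 2).differentiable_deriv_two _).fun_div
      (differentiable_τ n ϑ _) hx
  have h2 : HasDerivAt (fun z : ℂ => -σ n ϑ (-z)) (deriv (logDeriv (τ n ϑ)) (-x : ℂ)) (x : ℂ) := by
    refine (h1.hasDerivAt.comp (x : ℂ) (hasDerivAt_neg (x : ℂ))).fun_neg.congr_deriv ?_
    ring
  have h3 : (logDeriv fun y => hankel (fun k => reflectedDeriv ϑ k y) n) =
      fun y : ℝ => -σ n ϑ (-y : ℂ) := funext fun y => logDeriv_hankel_eq n ϑ y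
  rw [h3, h2.comp_ofReal.deriv, p]
  ring

theorem scale_mul_neg (x : ℝ) : (-((2 : ℝ) ^ (-(1 / 3) : ℝ) : ℝ) : ℂ) * (-x : ℂ) =
    (((2 : ℝ) ^ (-(1 / 3) : ℝ) * x : ℝ) : ℂ) := by push_cast; ring

/-- By the identity theorem, an entire function vanishing on a half-line vanishes at `0` too. -/
theorem frequently_φ_ne_zero {ϑ : ℂ} (h0 : φ ϑ 0 ≠ 0) :
    ∃ᶠ x : ℝ in atTop, reflectedDeriv ϑ 0 x ≠ 0 := by
  intro hcon
  obtain ⟨a, ha⟩ := eventually_atTop.1 hcon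
  have han : AnalyticOnNhd ℂ (fun z => φ ϑ (-z)) Set.univ :=
    DifferentiableOn.analyticOnNhd (fun z _ => ((hasDerivAt_φ ϑ (-z)).differentiableAt.comp z
      differentiable_neg.differentiableAt).differentiableWithinAt) isOpen_univ
  have hfreq : ∃ᶠ z in 𝓝[≠] (a : ℂ), (fun z => φ ϑ (-z)) z = (0 : ℂ → ℂ) z := by
    have htend : Tendsto (fun x : ℝ => (x : ℂ)) (𝓝[>] a) (𝓝[≠] (a : ℂ)) := by
      refine tendsto_nhdsWithin_iff.2 ⟨(Complex.continuous_ofReal.tendsto a).mono_left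
        nhdsWithin_le_nhds, ?_⟩
      filter_upwards [self_mem_nhdsWithin] with x hx
      simpa using (ne_of_gt hx : x ≠ a)
    refine htend.frequently (Eventually.frequently ?_)
    filter_upwards [self_mem_nhdsWithin] with x hx
    have := ha x (le_of_lt hx)
    rwa [not_not, reflectedDeriv_zero] at this
  have := congrFun (han.eq_of_frequently_eq (fun _ _ => analyticAt_const) hfreq) 0
  simp only [neg_zero] at this
  exact h0 this

theorem logDeriv_φ_recessive {ϑ : ℂ} (hϑ : Complex.sin ϑ = 0) :
    (∀ᶠ x in atTop, reflectedDeriv ϑ 0 x ≠ 0) ∧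
    Symbol (-4) (fun x => reflectedDeriv ϑ 1 x / reflectedDeriv ϑ 0 x -
      expansion ((-1 / √2 : ℝ) : ℂ) 1 x) := by
  have hs : (-1 / √2 : ℝ) ^ 2 = 1 / 2 := by rw [div_pow, Real.sq_sqrt] <;> norm_num
  have hd := hasDerivAt_reflectedDeriv ϑ 0
  have hd' := hasDerivAt_reflectedDeriv_one ϑ
  obtain ⟨C, hC⟩ := exists_norm_Ai_le
  have hcos : Complex.cos ϑ ≠ 0 := fun hc => by
    simpa [hϑ, hc] using Complex.sin_sq_add_cos_sq ϑ
  have hb : ∀ x : ℝ, 0 ≤ x → ‖reflectedDeriv ϑ 0 x‖ ≤ ‖Complex.cos ϑ‖ * C := by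
    intro x hx
    rw [reflectedDeriv_zero, φ, hϑ, zero_mul, add_zero, norm_mul, scale_mul_neg]
    gcongr
    exact (hC _ (by positivity)).1
  have hb' : ∀ x : ℝ, 0 ≤ x → ‖reflectedDeriv ϑ 1 x‖ ≤
      (2 : ℝ) ^ (-(1 / 3) : ℝ) * (‖Complex.cos ϑ‖ * C) := by
    intro x hx
    rw [reflectedDeriv_one, φDeriv, hϑ, zero_mul, add_zero, norm_neg, norm_mul, norm_mul,
      scale_mul_neg, norm_neg, Complex.norm_of_nonneg (by positivity)]
    gcongr
    exact (hC _ (by positivity)).2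
  have h0 := logDeriv_re_nonpos_of_bounded hd hd' hb
    (frequently_φ_ne_zero (by simpa [φ, hϑ] using ⟨hcos, Ai_zero_ne_zero⟩))
  have hO := logDeriv_sub_isBigO hs hd hd' h0.1 (Or.inr ⟨by
    have : 0 < √2 := by positivity
    exact div_neg_of_neg_of_pos (by norm_num) this, h0.2,
    IsBigO.of_bound _ (by filter_upwards [eventually_ge_atTop 0] with x hx; simpa using hb x hx),
    IsBigO.of_bound _ (by filter_upwards [eventually_ge_atTop 0] with x hx; simpa using hb' x hx)⟩)
  exact ⟨h0.1, symbol_logDeriv_sub_expansion hs hd hd' h0.1 hO⟩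

theorem logDeriv_φ_dominant {ϑ : ℂ} (hϑ : Complex.sin ϑ ≠ 0) :
    (∀ᶠ x in atTop, reflectedDeriv ϑ 0 x ≠ 0) ∧
    Symbol (-4) (fun x => reflectedDeriv ϑ 1 x / reflectedDeriv ϑ 0 x -
      expansion ((1 / √2 : ℝ) : ℂ) 1 x) := by
  have hs : (1 / √2 : ℝ) ^ 2 = 1 / 2 := by rw [div_pow, Real.sq_sqrt] <;> norm_num
  have hd := hasDerivAt_reflectedDeriv ϑ 0
  have hd' := hasDerivAt_reflectedDeriv_one ϑ
  obtain ⟨D, hD⟩ := exists_norm_Ai_le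
  have hub : ∀ C, ∃ x ≥ 0, C < ‖reflectedDeriv ϑ 0 x‖ := by
    intro C
    have hsin : 0 < ‖Complex.sin ϑ‖ := norm_pos_iff.2 hϑ
    obtain ⟨t, ht, ht0⟩ := ((Bi_unbounded ((C + 1 + ‖Complex.cos ϑ‖ * D) / ‖Complex.sin ϑ‖)).and
      (eventually_ge_atTop 0)).exists
    rw [div_le_iff₀ hsin] at ht
    have hκ : 0 < (2 : ℝ) ^ (-(1 / 3) : ℝ) := by positivity
    refine ⟨t / (2 : ℝ) ^ (-(1 / 3) : ℝ), by positivity, ?_⟩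
    rw [reflectedDeriv_zero, φ, scale_mul_neg, mul_div_cancel₀ _ hκ.ne']
    have h1 := norm_sub_le (Complex.cos ϑ * Ai t + Complex.sin ϑ * Bi t) (Complex.cos ϑ * Ai t)
    rw [add_sub_cancel_left, norm_mul, norm_mul] at h1
    have h2 := mul_le_mul_of_nonneg_left (hD t ht0).1 (norm_nonneg (Complex.cos ϑ))
    linarith
  have h0 := logDeriv_re_nonneg_of_unbounded hd hd' hub
  have hO := logDeriv_sub_isBigO hs hd hd' h0.1 (Or.inl ⟨by positivity, h0.2⟩)
  exact ⟨h0.1, symbol_logDeriv_sub_expansion hs hd hd' h0.1 hO⟩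

/-! ### Return from `x → ∞` to `z → -∞`. -/

theorem isBigO_atBot_of_symbol {m : ℝ} {k : ℤ} (hm : m = k) {f : ℝ → ℂ} (hf : Symbol m f) :
    (fun z : ℝ => f (-z)) =O[atBot] fun z : ℝ => z ^ k := by
  refine (hf.isBigO.comp_tendsto tendsto_neg_atBot_atTop).trans (IsBigO.of_bound 1 ?_)
  filter_upwards [eventually_lt_atBot 0] with z hz
  rw [Function.comp, hm, Real.rpow_intCast, norm_zpow, norm_neg, norm_zpow, one_mul]

theorem isBigO_σ_p {s : ℝ} (hs : s ^ 2 = 1 / 2) {ϑ : ℂ}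
    (h0 : ∀ᶠ x in atTop, reflectedDeriv ϑ 0 x ≠ 0)
    (h1 : Symbol (-4) (fun x => reflectedDeriv ϑ 1 x / reflectedDeriv ϑ 0 x - expansion s 1 x))
    (n : ℕ) :
    (∀ᶠ z : ℝ in atBot, τ n ϑ z ≠ 0) ∧
    ((fun z : ℝ => p n ϑ z - -2 * expansionDeriv s n (-z)) =O[atBot] fun z : ℝ => z ^ (-5 : ℤ)) ∧
    ((fun z : ℝ => σ n ϑ z - -expansion s n (-z)) =O[atBot] fun z : ℝ => z ^ (-4 : ℤ)) := by
  obtain ⟨hT, hS⟩ := symbol_logDeriv_hankel hs (hasDerivAt_reflectedDeriv ϑ) h0 h1 n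
  have hτ : ∀ᶠ x : ℝ in atTop, τ n ϑ (-x : ℂ) ≠ 0 := by simpa only [τ_neg_eq_hankel] using hT
  refine ⟨?_, ?_, ?_⟩
  · filter_upwards [tendsto_neg_atBot_atTop.eventually hτ] with z hz
    simpa using hz
  · have h2 : Symbol (-5) (fun x : ℝ => p n ϑ (-x : ℂ) - -2 * expansionDeriv s n x) := by
      refine ((hS.deriv.const_mul (-2)).mono (by norm_num)).congr ?_
      filter_upwards [deriv_eventuallyEq_of_symbol_sub hS, hτ] with x h3 h4
      rw [h3, deriv_logDeriv_hankel_eq n ϑ h4]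
      ring
    simpa using isBigO_atBot_of_symbol (k := -5) (by norm_num) h2
  · have h2 : Symbol (-4) (fun x : ℝ => σ n ϑ (-x : ℂ) - -expansion s n x) := by
      refine (hS.const_mul (-1)).congr (Eventually.of_forall fun x => ?_)
      simp only [logDeriv_hankel_eq]
      ring
    simpa using isBigO_atBot_of_symbol (k := -4) (by norm_num) h2

theorem neg_expansion_eq (ε : ℝ) (n : ℕ) {z : ℝ} (hz : z < 0) :
    -expansion ((ε / √2 : ℝ) : ℂ) n (-z) =
      ((-(ε * (n * (-z) ^ (1 / 2 : ℝ) / √2)) - (n : ℝ) ^ 2 / (4 * z)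
        + ε * (n * (4 * (n : ℝ) ^ 2 + 1) / (16 * √2 * (-z) ^ (5 / 2 : ℝ))) : ℝ) : ℂ) := by
  have hx : 0 < -z := neg_pos.2 hz
  have h1 : (-z) ^ (-1 : ℝ) = (-z)⁻¹ := Real.rpow_neg_one _
  have h2 : (-z) ^ (-5 / 2 : ℝ) = ((-z) ^ (5 / 2 : ℝ))⁻¹ := by
    rw [← Real.rpow_neg hx.le]
    norm_num
  rw [expansion, pw, pw, pw, h1, h2]
  push_cast
  have h3 : (z : ℂ) ≠ 0 := Complex.ofReal_ne_zero.2 hz.ne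
  have h4 : (((-z) ^ (5 / 2 : ℝ) : ℝ) : ℂ) ≠ 0 :=
    Complex.ofReal_ne_zero.2 (Real.rpow_pos_of_pos hx _).ne'
  field_simp
  ring

theorem expansionDeriv_eq (ε : ℝ) (n : ℕ) {z : ℝ} (hz : z < 0) :
    -2 * expansionDeriv ((ε / √2 : ℝ) : ℂ) n (-z) =
      ((-(ε * (n / (√2 * (-z) ^ (1 / 2 : ℝ)))) - (n : ℝ) ^ 2 / (2 * z ^ 2)
        - ε * (5 * n * (4 * (n : ℝ) ^ 2 + 1) / (16 * √2 * (-z) ^ (7 / 2 : ℝ))) : ℝ) : ℂ) := by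
  have hx : 0 < -z := neg_pos.2 hz
  have h1 : (-z) ^ (-2 : ℝ) = (z ^ 2)⁻¹ := by
    rw [Real.rpow_neg hx.le, Real.rpow_two, neg_sq]
  have h2 : (-z) ^ (-7 / 2 : ℝ) = ((-z) ^ (7 / 2 : ℝ))⁻¹ := by
    rw [← Real.rpow_neg hx.le]
    norm_num
  have h5 : (-z) ^ (-1 / 2 : ℝ) = ((-z) ^ (1 / 2 : ℝ))⁻¹ := by
    rw [← Real.rpow_neg hx.le]
    norm_num
  rw [expansionDeriv, pw, pw, pw, h1, h2, h5]
  push_cast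
  ring

/-- The parameter `ε = ±1` treats both cases at once; `e₁` and `e₂` are left free so that the signs
may be written as in the final statement. Since `σₙ(z) = -Lₙ(-z)`, the sign of `s` is reversed
there. -/
theorem isBigO_congr_expansion {ε : ℝ} {n : ℕ} {ϑ : ℂ} {e₁ e₂ : ℝ → ℝ}
    (h₁ : ∀ z, e₁ z = -(ε * (n / (√2 * (-z) ^ (1 / 2 : ℝ)))) - (n : ℝ) ^ 2 / (2 * z ^ 2)
        - ε * (5 * n * (4 * (n : ℝ) ^ 2 + 1) / (16 * √2 * (-z) ^ (7 / 2 : ℝ))))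
    (h₂ : ∀ z, e₂ z = -(ε * (n * (-z) ^ (1 / 2 : ℝ) / √2)) - (n : ℝ) ^ 2 / (4 * z)
        + ε * (n * (4 * (n : ℝ) ^ 2 + 1) / (16 * √2 * (-z) ^ (5 / 2 : ℝ))))
    (hp : (fun z : ℝ => p n ϑ z - -2 * expansionDeriv ((ε / √2 : ℝ) : ℂ) n (-z)) =O[atBot]
      fun z : ℝ => z ^ (-5 : ℤ))
    (hσ : (fun z : ℝ => σ n ϑ z - -expansion ((ε / √2 : ℝ) : ℂ) n (-z)) =O[atBot]
      fun z : ℝ => z ^ (-4 : ℤ)) :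
    ((fun z : ℝ => p n ϑ z - (e₁ z : ℂ)) =O[atBot] fun z : ℝ => z ^ (-5 : ℤ)) ∧
    ((fun z : ℝ => σ n ϑ z - (e₂ z : ℂ)) =O[atBot] fun z : ℝ => z ^ (-4 : ℤ)) := by
  refine ⟨hp.congr' ?_ EventuallyEq.rfl, hσ.congr' ?_ EventuallyEq.rfl⟩
  · filter_upwards [eventually_lt_atBot 0] with z hz
    rw [expansionDeriv_eq ε n hz, h₁]
  · filter_upwards [eventually_lt_atBot 0] with z hz
    rw [neg_expansion_eq ε n hz, h₂]

end AiryHankel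

theorem theorem3p7 (n : ℕ) (ϑ : ℂ) :
    (∀ᶠ z : ℝ in atBot, AiryPainleve.τ n ϑ z ≠ 0) ∧
    (Complex.sin ϑ = 0 →
      ((fun z : ℝ => AiryPainleve.p n ϑ z -
          ((n / (√2 * (-z) ^ (1 / 2 : ℝ)) - (n : ℝ) ^ 2 / (2 * z ^ 2)
            + 5 * n * (4 * (n : ℝ) ^ 2 + 1) / (16 * √2 * (-z) ^ (7 / 2 : ℝ)) : ℝ) : ℂ))
        =O[atBot] fun z : ℝ => z ^ (-5 : ℤ)) ∧
      ((fun z : ℝ => AiryPainleve.σ n ϑ z -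
          ((n * (-z) ^ (1 / 2 : ℝ) / √2 - (n : ℝ) ^ 2 / (4 * z)
            - n * (4 * (n : ℝ) ^ 2 + 1) / (16 * √2 * (-z) ^ (5 / 2 : ℝ)) : ℝ) : ℂ))
        =O[atBot] fun z : ℝ => z ^ (-4 : ℤ))) ∧
    (Complex.sin ϑ ≠ 0 →
      ((fun z : ℝ => AiryPainleve.p n ϑ z -
          ((-(n / (√2 * (-z) ^ (1 / 2 : ℝ))) - (n : ℝ) ^ 2 / (2 * z ^ 2)
            - 5 * n * (4 * (n : ℝ) ^ 2 + 1) / (16 * √2 * (-z) ^ (7 / 2 : ℝ)) : ℝ) : ℂ))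
        =O[atBot] fun z : ℝ => z ^ (-5 : ℤ)) ∧
      ((fun z : ℝ => AiryPainleve.σ n ϑ z -
          ((-(n * (-z) ^ (1 / 2 : ℝ) / √2) - (n : ℝ) ^ 2 / (4 * z)
            + n * (4 * (n : ℝ) ^ 2 + 1) / (16 * √2 * (-z) ^ (5 / 2 : ℝ)) : ℝ) : ℂ))
        =O[atBot] fun z : ℝ => z ^ (-4 : ℤ))) := by
  by_cases hϑ : Complex.sin ϑ = 0
  · obtain ⟨h0, h1⟩ := AiryHankel.logDeriv_φ_recessive hϑ
    obtain ⟨hτ, hp, hσ⟩ := AiryHankel.isBigO_σ_p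
      (by rw [div_pow, Real.sq_sqrt] <;> norm_num) h0 h1 n
    exact ⟨hτ, fun _ => AiryHankel.isBigO_congr_expansion (fun z => by ring) (fun z => by ring) hp hσ,
      fun h => absurd hϑ h⟩
  · obtain ⟨h0, h1⟩ := AiryHankel.logDeriv_φ_dominant hϑ
    obtain ⟨hτ, hp, hσ⟩ := AiryHankel.isBigO_σ_p
      (by rw [div_pow, Real.sq_sqrt] <;> norm_num) h0 h1 n
    exact ⟨hτ, fun h => absurd h hϑ,
      fun _ => AiryHankel.isBigO_congr_expansion (fun z => by ring) (fun z => by ring) hp hσ⟩
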